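/- **Setting.** For $1\le p<\infty$ let $L_p$ be the space of real $2\pi$-periodic functions with finite norm $\|f\|_p=\big(\int_0^{2\pi}|f(t)|^p\,dt\big)^{1/p}$ (the same formula is used for the norm of complex-valued functions), and let $\hat f(k)=\frac1{2\pi}\int_{-\pi}^{\pi}f(t)e^{-ikt}\,dt$. Let $\mathfrak M$ be the set of positive convex continuous functions $\psi$ on $[1,\infty)$ with $\lim_{t\to\infty}\psi(t)=0$. For $\psi\in\mathfrak M$ put $\eta(t)=\psi^{-1}(\psi(t)/2)$ and $\mu(t)=\frac{t}{\eta(t)-t}$, $t\ge1$. Let $\mathfrak M''_\infty$ be the set of all $\psi\in\mathfrak M$ such that $\mu$ is nondecreasing on $[1,\infty)$ with $\mu(t)\to\infty$ as $t\to\infty$, and such that there is $K>0$ with $\eta(t)-t\ge K$ for all $t\ge1$. For $\beta\in\mathbb R$, let $L^\psi_{\beta,1}$ be the class of all $f\in L_1$ for which there is $\varphi\in L_1$ with $\|\varphi\|_1\le1$, $\int_0^{2\pi}\varphi(t)\,dt=0$ and whose Fourier series is $$\sum_{k\in\mathbb Z\setminus\{0\}}\frac{\hat f(k)}{\psi(|k|)}\,e^{i\left(kx+\frac{\beta\pi}{2}\operatorname{sign}k\right)}.$$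 For $m\in\mathbb N$ put $$e^{\bot}_m(L^\psi_{\beta,1})_s=\sup_{f\in L^\psi_{\beta,1}}\ \inf_{\gamma\subset\mathbb Z,\ |\gamma|=m}\Big\|f(x)-\sum_{k\in\gamma}\hat f(k)e^{ikx}\Big\|_s .$$ Write $a_n\asymp b_n$ if there are constants $C_1,C_2>0$ independent of $n$ with $C_1a_n\le b_n\le C_2a_n$ for all $n\ge 1$. **Theorem.** Let $1<s<\infty$, $\frac1s+\frac1{s'}=1$, let $\psi\in\mathfrak M''_\infty$, and suppose that $\frac{\psi(t)}{|\psi'(t)|}$ increases to $\infty$ as $t\to\infty$, that is, it is nondecreasing for all sufficiently large $t$ and tends to $\infty$ (here $\psi'$ is the right derivative, which coincides with the derivative wherever $\psi$ is differentiable). Then for every $\beta\in\mathbb R$ $$e^{\bot}_{2n-1}(L^\psi_{\beta,1})_s\asymp e^{\bot}_{2n}(L^\psi_{\beta,1})_s\asymp \psi(n)\,(\eta(n)-n)^{1/s'} .$$ -/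

import Mathlib

open MeasureTheory Set Filter Topology
open scoped ENNReal NNReal

noncomputable section

namespace OrthApprox

/-- Lebesgue measure on one period `[0, 2π)` (total mass `2π`, not normalised). -/
def periodMeasure : Measure ℝ := volume.restrict (Ico 0 (2 * Real.pi))

/-- `f ∈ L_p`: a real `2π`-periodic function, `p`-integrable over a period
(essentially bounded if `p = ∞`). -/
def IsPeriodicLp (p : ℝ≥0∞) (f : ℝ → ℝ) : Prop :=
  Function.Periodic f (2 * Real.pi) ∧ MemLp f p periodMeasure

/-- The Fourier coefficient `(1 / 2π) ∫_{-π}^{π} f(t) e^{-ikt} dt`. -/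
def coeff (f : ℝ → ℝ) (k : ℤ) : ℂ :=
  fourierCoeffOn (neg_lt_self Real.pi_pos) (fun t => (f t : ℂ)) k

/-- `φ ∈ L_1` is the `(ψ, β)`-derivative of `f`: the Fourier series of `φ` is
`∑_{k ≠ 0} (f̂(k) / ψ(|k|)) e^{i(kx + (βπ/2) sign k)}`. -/
def IsPsiBetaDeriv (ψ : ℝ → ℝ) (β : ℝ) (f φ : ℝ → ℝ) : Prop :=
  IsPeriodicLp 1 φ ∧ coeff φ 0 = 0 ∧
    ∀ k : ℤ, k ≠ 0 →
      coeff φ k = coeff f k / (ψ (|k| : ℤ) : ℂ) *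
        Complex.exp (Complex.I * ((β * Real.pi / 2 * (k.sign : ℝ) : ℝ) : ℂ))

/-- `B_p^0`: the functions of the unit ball of `L_p` that are orthogonal to constants. -/
def unitBallZero (p : ℝ≥0∞) : Set (ℝ → ℝ) :=
  {φ | IsPeriodicLp p φ ∧ eLpNorm φ p periodMeasure ≤ 1 ∧ ∫ t, φ t ∂periodMeasure = 0}

/-- The class `L^ψ_{β,p}`: functions `f ∈ L_1` whose `(ψ, β)`-derivative exists and lies
in `B_p^0`. -/
def psiClass (ψ : ℝ → ℝ) (β : ℝ) (p : ℝ≥0∞) : Set (ℝ → ℝ) :=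
  {f | IsPeriodicLp 1 f ∧ ∃ φ, IsPsiBetaDeriv ψ β f φ ∧ φ ∈ unitBallZero p}

/-- `S_γ(f; x) = ∑_{k ∈ γ} f̂(k) e^{ikx}`. -/
def partialSum (γ : Finset ℤ) (f : ℝ → ℝ) (x : ℝ) : ℂ :=
  ∑ k ∈ γ, coeff f k * Complex.exp (Complex.I * k * x)

/-- `e^⊥_m(f)_s = inf_γ ‖f - S_γ(f)‖_s`, over all sets `γ` of `m` integers. -/
def bestOrth (m : ℕ) (s : ℝ≥0∞) (f : ℝ → ℝ) : ℝ≥0∞ :=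
  ⨅ (γ : Finset ℤ) (_ : γ.card = m),
    eLpNorm (fun x => (f x : ℂ) - partialSum γ f x) s periodMeasure

/-- `e^⊥_m(𝔑)_s = sup_{f ∈ 𝔑} e^⊥_m(f)_s`. -/
def bestOrthClass (m : ℕ) (s : ℝ≥0∞) (𝔑 : Set (ℝ → ℝ)) : ℝ≥0∞ :=
  ⨆ f ∈ 𝔑, bestOrth m s f

/-- The set `𝔐` of positive convex continuous functions on `[1, ∞)` that tend to `0` at
infinity. Only the values on `[1, ∞)` matter. -/
def classM : Set (ℝ → ℝ) :=
  {ψ | (∀ t, 1 ≤ t → 0 < ψ t) ∧ ConvexOn ℝ (Ici 1) ψ ∧ ContinuousOn ψ (Ici 1) ∧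
    Tendsto ψ atTop (𝓝 0)}

/-- `η(ψ; t) = ψ⁻¹(ψ(t) / 2)`, where `ψ⁻¹` is the inverse of `ψ` on `[1, ∞)`
(a function in `𝔐` is a bijection of `[1, ∞)` onto `(0, ψ 1]`). -/
def eta (ψ : ℝ → ℝ) (t : ℝ) : ℝ := Function.invFunOn ψ (Ici 1) (ψ t / 2)

/-- `μ(ψ; t) = t / (η(ψ; t) - t)`. -/
def mu (ψ : ℝ → ℝ) (t : ℝ) : ℝ := t / (eta ψ t - t)

/-- `𝔐⁺_∞`: those `ψ ∈ 𝔐` for which `μ(ψ; t)` increases to `∞` on `[1, ∞)`. -/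
def classMPlus : Set (ℝ → ℝ) :=
  {ψ | ψ ∈ classM ∧ MonotoneOn (mu ψ) (Ici 1) ∧ Tendsto (mu ψ) atTop atTop}

/-- `𝔐''_∞`: those `ψ ∈ 𝔐⁺_∞` for which `η(ψ; t) - t` is bounded below by a positive
constant on `[1, ∞)`. -/
def classMTwo : Set (ℝ → ℝ) :=
  {ψ | ψ ∈ classMPlus ∧ ∃ K : ℝ, 0 < K ∧ ∀ t, 1 ≤ t → K ≤ eta ψ t - t}

/-- `ψ(t) / |ψ'(t)|`, with `ψ'` the right derivative. It exists at every `t > 1` for a convex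
`ψ`, and is the derivative wherever `ψ` is differentiable. -/
def decayRatio (ψ : ℝ → ℝ) (t : ℝ) : ℝ := ψ t / |derivWithin ψ (Ioi t) t|

/-- `g(t) ↑ ∞` as `t → ∞`: `g` is nondecreasing from some point on, and tends to `∞`. -/
def IncreasesToInfinity (g : ℝ → ℝ) : Prop :=
  (∃ T : ℝ, MonotoneOn g (Ici T)) ∧ Tendsto g atTop atTop

/-- `a_n ≍ b_n` for `n = 1, 2, …`: there are positive (finite) constants `C₁`, `C₂` such that
`C₁ a_n ≤ b_n ≤ C₂ a_n` for all `n`. -/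
def SameOrder (a b : ℕ → ℝ≥0∞) : Prop :=
  ∃ C₁ C₂ : ℝ≥0, 0 < C₁ ∧ 0 < C₂ ∧
    ∀ n : ℕ, 1 ≤ n → C₁ * a n ≤ b n ∧ b n ≤ C₂ * a n

end OrthApprox

end

namespace OrthApprox

/-! Write L = η(n) - n. Both bounds rest on one estimate: a trigonometric kernel with monotone
coefficients of size at most B and coefficient sum at most Bλ is bounded, up to constants, by
B·min(λ, 1/dist(x, 2πℤ)), because Abel summation controls it away from 0. Hence its L_s norm is O(B
λ^(1-1/s)) (`eLpNorm_trigPoly_band_le`).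

Upper bound. Delete a block of consecutive frequencies containing all |k| < n. The remainder is φ
convolved with a kernel whose coefficients have modulus ψ(|k|), |k| ≥ n, and convolution with the
unit ball of L_1 does not increase the L_s norm of the kernel (`eLpNorm_multiplier_le`). Here B =
ψ(n) and λ is of order L: ψ halves from n to η(n), while monotonicity of μ keeps successive gaps
η(t) - t from growing too fast, so the tail sum is dominated by a geometric series
(`exists_sum_Ico_le`).

Lower bound. Let N = n + ⌈L⌉ and let f be the (ψ, β)-integral of a normalised Fejér kernel of degree
2N. Test f - S_γ(f) against the polynomial g with coefficients ψ(n)/ψ(|k|), 1 ≤ |k| ≤ N, carrying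
the same phases. The weights ψ and the phases cancel, so each frequency outside γ contributes at
least a constant times ψ(n). A set γ of at most 2n frequencies leaves at least 2L of them, so the
pairing is at least of order ψ(n)L, whatever γ is. Since ψ/|ψ'| is eventually nondecreasing, 1/ψ
grows fast enough for its sum up to N to be O(L/ψ(n)) (`exists_sum_inv_le`). The kernel estimate
then gives ‖g‖_{s'} = O(L^(1/s)), and Hölder's inequality yields ψ(n)L^(1/s'). -/

/-! ### Fourier coefficients and uniqueness on one period -/

lemma integral_periodMeasure {E : Type*} [NormedAddCommGroup E] [NormedSpace ℝ E] (f : ℝ → E) :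
    ∫ t, f t ∂periodMeasure = ∫ t in (0 : ℝ)..2 * Real.pi, f t := by
  rw [periodMeasure, integral_Ico_eq_integral_Ioc,
    intervalIntegral.integral_of_le Real.two_pi_pos.le]

instance : IsFiniteMeasure periodMeasure := by
  unfold periodMeasure; infer_instance

lemma exp_periodic (k : ℤ) :
    Function.Periodic (fun t : ℝ => Complex.exp (Complex.I * k * t)) (2 * Real.pi) := by
  intro t
  have : Complex.I * k * ((t + 2 * Real.pi : ℝ) : ℂ)
      = Complex.I * k * t + k * (2 * Real.pi * Complex.I) := by push_cast; ring
  simp only [this, Complex.exp_add, Complex.exp_int_mul_two_pi_mul_I, mul_one]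

lemma norm_exp_I_mul (k : ℤ) (t : ℝ) : ‖Complex.exp (Complex.I * k * t)‖ = 1 := by
  have : Complex.I * k * t = ((k * t : ℝ) : ℂ) * Complex.I := by push_cast; ring
  rw [this, Complex.norm_exp_ofReal_mul_I]

lemma continuous_exp_I_mul (k : ℤ) :
    Continuous (fun t : ℝ => Complex.exp (Complex.I * k * t)) := by fun_prop

lemma coeff_eq_integral {f : ℝ → ℝ} (hf : Function.Periodic f (2 * Real.pi)) (k : ℤ) :
    coeff f k = (2 * Real.pi : ℂ)⁻¹ *
      ∫ t, Complex.exp (Complex.I * (-k : ℤ) * t) * (f t : ℂ) ∂periodMeasure := by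
  rw [coeff, fourierCoeffOn_eq_integral, integral_periodMeasure]
  have hper : Function.Periodic
      (fun t : ℝ => Complex.exp (Complex.I * (-k : ℤ) * t) * (f t : ℂ)) (2 * Real.pi) := by
    intro t
    have h := exp_periodic (-k) t
    simp only at h ⊢
    rw [h, hf t]
  have h := hper.intervalIntegral_add_eq (-Real.pi) 0
  rw [zero_add, show -Real.pi + 2 * Real.pi = Real.pi by ring] at h
  rw [← h, show (Real.pi - -Real.pi) = 2 * Real.pi by ring, Complex.real_smul]
  congr 1
  · push_cast; ring
  · refine intervalIntegral.integral_congr fun t _ => ?_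
    simp only [smul_eq_mul, fourier_coe_apply]
    congr 2
    have : (Real.pi : ℂ) ≠ 0 := by exact_mod_cast Real.pi_ne_zero
    push_cast
    field_simp

lemma integral_exp_I_mul (k : ℤ) :
    ∫ t, Complex.exp (Complex.I * k * t) ∂periodMeasure = if k = 0 then (2 * Real.pi : ℂ) else 0 := by
  rw [integral_periodMeasure]
  split_ifs with h
  · simp [h]
  · have hk : Complex.I * k ≠ 0 := mul_ne_zero Complex.I_ne_zero (by exact_mod_cast h)
    rw [integral_exp_mul_complex hk]
    have := exp_periodic k 0
    simp only [zero_add] at this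
    rw [this]; simp

lemma integrable_exp_mul {h : ℝ → ℂ} (hh : Integrable h periodMeasure) (k : ℤ) :
    Integrable (fun t : ℝ => Complex.exp (Complex.I * k * t) * h t) periodMeasure :=
  hh.bdd_mul (continuous_exp_I_mul k).aestronglyMeasurable
    (Eventually.of_forall fun t => (norm_exp_I_mul k t).le)

/-- Uniqueness of Fourier coefficients for integrable functions. -/
lemma ae_eq_zero_of_forall_integral_exp_eq_zero {h : ℝ → ℂ} (hh : Integrable h periodMeasure)
    (h0 : ∀ k : ℤ, ∫ t, Complex.exp (Complex.I * k * t) * h t ∂periodMeasure = 0) :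
    h =ᵐ[periodMeasure] 0 := by
  have : Fact (0 < 2 * Real.pi) := ⟨Real.two_pi_pos⟩
  have hint : ∀ g : C(AddCircle (2 * Real.pi), ℂ),
      Integrable (fun t : ℝ => g t * h t) periodMeasure := fun g =>
    hh.bdd_mul (c := ‖g‖) (g.continuous.comp (AddCircle.continuous_mk' _)).aestronglyMeasurable
      (Eventually.of_forall fun t => g.norm_coe_le_norm _)
  -- Integration against h is a continuous functional on C(circle) that kills every exponential,
  -- hence everything by density of trigonometric polynomials.
  let Λ : C(AddCircle (2 * Real.pi), ℂ) →ₗ[ℂ] ℂ :=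
    { toFun := fun g => ∫ t, g (t : AddCircle (2 * Real.pi)) * h t ∂periodMeasure
      map_add' := fun g₁ g₂ => by
        simp only [ContinuousMap.add_apply, add_mul]
        exact integral_add (hint g₁) (hint g₂)
      map_smul' := fun c g => by
        simp only [ContinuousMap.smul_apply, smul_eq_mul, mul_assoc, RingHom.id_apply]
        exact integral_const_mul _ _ }
  let Λ' := Λ.mkContinuous (∫ t, ‖h t‖ ∂periodMeasure) fun g => by
    calc ‖Λ g‖ ≤ ∫ t, ‖g (t : AddCircle (2 * Real.pi)) * h t‖ ∂periodMeasure :=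
          norm_integral_le_integral_norm _
      _ ≤ ∫ t, ‖h t‖ * ‖g‖ ∂periodMeasure := by
          refine integral_mono (hint g).norm (hh.norm.mul_const _) fun t => ?_
          simp only [norm_mul]
          rw [mul_comm]
          exact mul_le_mul_of_nonneg_left (g.norm_coe_le_norm _) (norm_nonneg _)
      _ = _ := integral_mul_const _ _
  have hker : (⊤ : Submodule ℂ C(AddCircle (2 * Real.pi), ℂ)) ≤ Λ'.ker := by
    rw [← span_fourier_closure_eq_top]
    refine Submodule.topologicalClosure_minimal _ (Submodule.span_le.2 ?_) Λ'.isClosed_ker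
    rintro _ ⟨k, rfl⟩
    change ∫ t, fourier k (t : AddCircle (2 * Real.pi)) * h t ∂periodMeasure = 0
    rw [← h0 k]
    refine integral_congr_ae (Eventually.of_forall fun t => ?_)
    simp only [fourier_coe_apply]
    congr 2
    have : (Real.pi : ℂ) ≠ 0 := by exact_mod_cast Real.pi_ne_zero
    push_cast
    field_simp
  have hzero : ∀ g : C(AddCircle (2 * Real.pi), ℂ),
      ∫ t, g (t : AddCircle (2 * Real.pi)) * h t ∂periodMeasure = 0 := fun g =>
    hker (Submodule.mem_top (x := g))
  have hio : IntegrableOn h (Ioo 0 (2 * Real.pi)) volume := by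
    have : IntegrableOn h (Ico 0 (2 * Real.pi)) volume := hh
    exact this.mono_set Ioo_subset_Ico_self
  -- Test functions supported in the open interval vanish at both endpoints, so they descend to
  -- continuous functions on the circle.
  have key := isOpen_Ioo.ae_eq_zero_of_integral_contDiff_smul_eq_zero (μ := volume)
    (f := h) (U := Ioo 0 (2 * Real.pi)) hio.locallyIntegrableOn (by
      intro g hg hgc hgs
      have g0 : g 0 = 0 := image_eq_zero_of_notMem_tsupport fun hm => (hgs hm).1.false
      have g1 : g (2 * Real.pi) = 0 := image_eq_zero_of_notMem_tsupport fun hm => (hgs hm).2.false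
      let G : C(AddCircle (2 * Real.pi), ℂ) :=
        ⟨AddCircle.liftIco (2 * Real.pi) 0 (fun t => (g t : ℂ)),
          AddCircle.liftIco_zero_continuous (by simp [g0, g1])
            (Complex.continuous_ofReal.comp hg.continuous).continuousOn⟩
      rw [← hzero G, periodMeasure]
      have hsup : ∀ x, x ∉ Ico 0 (2 * Real.pi) → g x • h x = 0 := fun x hx => by
        rw [image_eq_zero_of_notMem_tsupport fun hm => hx (Ioo_subset_Ico_self (hgs hm)), zero_smul]
      rw [← setIntegral_eq_integral_of_forall_compl_eq_zero hsup]
      refine setIntegral_congr_fun measurableSet_Ico fun x hx => ?_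
      have : G (x : AddCircle (2 * Real.pi)) = (g x : ℂ) :=
        AddCircle.liftIco_coe_apply (p := 2 * Real.pi) (a := (0 : ℝ))
          (f := fun t => (g t : ℂ)) (by simpa using hx)
      simp only [this, Complex.real_smul])
  rw [periodMeasure, Measure.restrict_congr_set Ioo_ae_eq_Ico.symm]
  exact (ae_restrict_iff' measurableSet_Ioo).2 key

/-- Absolutely convergent Fourier series represent the function almost everywhere. -/
lemma ae_hasSum_coeff {f : ℝ → ℝ} (hf : IsPeriodicLp 1 f) (hs : Summable fun k => ‖coeff f k‖) :
    ∀ᵐ x : ℝ ∂periodMeasure,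
      HasSum (fun k : ℤ => coeff f k * Complex.exp (Complex.I * k * x)) (f x : ℂ) := by
  have hsum : ∀ x : ℝ, Summable fun k : ℤ => coeff f k * Complex.exp (Complex.I * k * x) :=
    fun x => Summable.of_norm (by simpa only [norm_mul, norm_exp_I_mul, mul_one] using hs)
  have hfi : Integrable (fun t => (f t : ℂ)) periodMeasure :=
    (memLp_one_iff_integrable.1 hf.2).ofReal
  set F : ℝ → ℂ := fun x => ∑' k : ℤ, coeff f k * Complex.exp (Complex.I * k * x) with hF
  have hFc : Continuous F := by
    refine continuous_tsum (fun k => by fun_prop) hs fun k x => ?_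
    rw [norm_mul, norm_exp_I_mul, mul_one]
  have hFi : Integrable F periodMeasure := by
    refine Integrable.of_bound hFc.aestronglyMeasurable (∑' k, ‖coeff f k‖)
      (Eventually.of_forall fun x => ?_)
    refine (norm_tsum_le_tsum_norm (by simpa only [norm_mul, norm_exp_I_mul, mul_one] using hs)).trans
      (le_of_eq ?_)
    simp only [norm_mul, norm_exp_I_mul, mul_one]
  have key := ae_eq_zero_of_forall_integral_exp_eq_zero (hfi.sub hFi) (by
    intro k
    simp only [Pi.sub_apply, mul_sub]
    rw [integral_sub (integrable_exp_mul hfi k) (integrable_exp_mul hFi k), sub_eq_zero]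
    have h1 : ∫ t, Complex.exp (Complex.I * k * t) * (f t : ℂ) ∂periodMeasure
        = 2 * Real.pi * coeff f (-k) := by
      rw [coeff_eq_integral hf.1, neg_neg]
      have : (Real.pi : ℂ) ≠ 0 := by exact_mod_cast Real.pi_ne_zero
      field_simp
    rw [h1]
    have h2 : ∀ j : ℤ, ∫ t, Complex.exp (Complex.I * k * t) *
        (coeff f j * Complex.exp (Complex.I * j * t)) ∂periodMeasure
        = if j = -k then 2 * Real.pi * coeff f (-k) else 0 := by
      intro j
      have : ∀ t : ℝ, Complex.exp (Complex.I * k * t) *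
        (coeff f j * Complex.exp (Complex.I * j * t))
          = coeff f j * Complex.exp (Complex.I * (k + j : ℤ) * t) := by
        intro t
        rw [mul_left_comm, ← Complex.exp_add]; push_cast; ring_nf
      simp only [this]
      rw [integral_const_mul, integral_exp_I_mul]
      by_cases hj : j = -k
      · simp [hj, mul_comm]
      · rw [if_neg hj, if_neg (by omega), mul_zero]
    have h3 : HasSum (fun j : ℤ => ∫ t, Complex.exp (Complex.I * k * t) *
        (coeff f j * Complex.exp (Complex.I * j * t)) ∂periodMeasure)
        (∫ t, ∑' j : ℤ, Complex.exp (Complex.I * k * t) *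
        (coeff f j * Complex.exp (Complex.I * j * t)) ∂periodMeasure) := by
      refine hasSum_integral_of_summable_integral_norm (fun j => ?_) ?_
      · refine integrable_exp_mul (Integrable.of_bound (C := ‖coeff f j‖) ?_ ?_) k
        · exact Continuous.aestronglyMeasurable (by fun_prop)
        · exact Eventually.of_forall fun x => by rw [norm_mul, norm_exp_I_mul, mul_one]
      · simp only [norm_mul, norm_exp_I_mul, mul_one, one_mul, integral_const]
        exact hs.const_smul _
    simp only [h2] at h3
    have h4 := h3.unique (hasSum_ite_eq (-k) (2 * Real.pi * coeff f (-k)))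
    rw [← h4]
    refine integral_congr_ae (Eventually.of_forall fun t => ?_)
    simp only [hF]
    rw [tsum_mul_left])
  filter_upwards [key] with x hx
  have : (f x : ℂ) = F x := sub_eq_zero.1 hx
  rw [this]
  exact (hsum x).hasSum

/-! ### Trigonometric polynomials and convolution with L_1 -/

/-- The trigonometric polynomial `∑_{k ∈ S} c_k e^{ikx}`. -/
noncomputable def trigPoly (c : ℤ → ℂ) (S : Finset ℤ) (x : ℝ) : ℂ :=
  ∑ k ∈ S, c k * Complex.exp (Complex.I * k * x)

lemma continuous_trigPoly (c : ℤ → ℂ) (S : Finset ℤ) : Continuous (trigPoly c S) := by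
  unfold trigPoly; fun_prop

lemma periodic_trigPoly (c : ℤ → ℂ) (S : Finset ℤ) :
    Function.Periodic (trigPoly c S) (2 * Real.pi) := fun x =>
  Finset.sum_congr rfl fun k _ => by
    have := exp_periodic k x
    simp only at this
    rw [this]

lemma integrable_of_continuous {g : ℝ → ℂ} (hg : Continuous g) : Integrable g periodMeasure :=
  (hg.integrableOn_Icc (a := 0) (b := 2 * Real.pi)).mono_set Ico_subset_Icc_self

lemma lintegral_enorm_rpow_sub {K : ℝ → ℂ} (hK : Continuous K)
    (hper : Function.Periodic K (2 * Real.pi)) {s : ℝ} (hs : 0 < s) (t : ℝ) :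
    ∫⁻ x, ‖K (x - t)‖ₑ ^ s ∂periodMeasure = ∫⁻ x, ‖K x‖ₑ ^ s ∂periodMeasure := by
  have key : ∀ G : ℝ → ℂ, Continuous G → ∫⁻ x, ‖G x‖ₑ ^ s ∂periodMeasure
      = ENNReal.ofReal (∫ x in (0 : ℝ)..2 * Real.pi, ‖G x‖ ^ s) := by
    intro G hG
    have hc : Continuous fun x => ‖G x‖ ^ s := hG.norm.rpow_const fun _ => Or.inr hs.le
    rw [← integral_periodMeasure, ofReal_integral_eq_lintegral_ofReal]
    · refine lintegral_congr fun x => ?_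
      rw [← ENNReal.ofReal_rpow_of_nonneg (norm_nonneg _) hs.le, ofReal_norm]
    · exact (hc.integrableOn_Icc (a := 0) (b := 2 * Real.pi)).mono_set Ico_subset_Icc_self
    · exact Eventually.of_forall fun x => by positivity
  rw [key (fun x => K (x - t)) (by fun_prop), key K hK]
  congr 1
  rw [intervalIntegral.integral_comp_sub_right (fun x => ‖K x‖ ^ s) t]
  have hp : Function.Periodic (fun x => ‖K x‖ ^ s) (2 * Real.pi) := fun x => by simp only [hper x]
  have := hp.intervalIntegral_add_eq (0 - t) 0
  rw [zero_add] at this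
  rw [← this]
  congr 1; ring

/-- The multiplier operator with symbol `κ` is bounded from `L_1` to `L_s` by the `L_s` norm of its
kernel. -/
lemma eLpNorm_multiplier_le {φ : ℝ → ℝ} (hφ : IsPeriodicLp 1 φ)
    (hφ1 : eLpNorm φ 1 periodMeasure ≤ 1) {s : ℝ} (hs : 1 < s) (κ : ℤ → ℂ) (S : Finset ℤ) :
    eLpNorm (trigPoly (fun k => coeff φ k * κ k) S) (ENNReal.ofReal s) periodMeasure
      ≤ eLpNorm (trigPoly κ S) (ENNReal.ofReal s) periodMeasure := by
  have hs0 : 0 < s := one_pos.trans hs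
  have hφi : Integrable (fun t => (φ t : ℂ)) periodMeasure :=
    (memLp_one_iff_integrable.1 hφ.2).ofReal
  have hKc := continuous_trigPoly κ S
  have hconv : ∀ x, trigPoly (fun k => coeff φ k * κ k) S x
      = (2 * Real.pi : ℂ)⁻¹ * ∫ t, (φ t : ℂ) * trigPoly κ S (x - t) ∂periodMeasure := by
    intro x
    have h1 : ∀ t, (φ t : ℂ) * trigPoly κ S (x - t) = ∑ k ∈ S,
        κ k * Complex.exp (Complex.I * k * x) *
          (Complex.exp (Complex.I * (-k : ℤ) * t) * (φ t : ℂ)) := by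
      intro t
      rw [trigPoly, Finset.mul_sum]
      refine Finset.sum_congr rfl fun k _ => ?_
      have : Complex.exp (Complex.I * k * (x - t : ℝ))
          = Complex.exp (Complex.I * k * x) * Complex.exp (Complex.I * (-k : ℤ) * t) := by
        rw [← Complex.exp_add]; push_cast; ring_nf
      rw [this]; ring
    simp only [h1]
    rw [integral_finsetSum _ fun k _ => (integrable_exp_mul hφi _).const_mul _, Finset.mul_sum,
      trigPoly]
    refine Finset.sum_congr rfl fun k _ => ?_
    rw [integral_const_mul, coeff_eq_integral hφ.1]
    ring
  have hφm : AEMeasurable (fun t => ‖φ t‖ₑ) periodMeasure := hφ.2.1.enorm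
  have hφ1' : ∫⁻ t, ‖φ t‖ₑ ∂periodMeasure ≤ 1 := by
    rwa [eLpNorm_one_eq_lintegral_enorm] at hφ1
  have hpt : ∀ x, ‖trigPoly (fun k => coeff φ k * κ k) S x‖ₑ ^ s
      ≤ ∫⁻ t, ‖φ t‖ₑ * ‖trigPoly κ S (x - t)‖ₑ ^ s ∂periodMeasure := by
    intro x
    have hq : s.HolderConjugate (s / (s - 1)) := Real.HolderConjugate.conjExponent hs
    have hKm : AEMeasurable (fun t => ‖trigPoly κ S (x - t)‖ₑ) periodMeasure :=
      (Continuous.enorm (by fun_prop)).measurable.aemeasurable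
    have h2 : ‖trigPoly (fun k => coeff φ k * κ k) S x‖ₑ
        ≤ ∫⁻ t, ‖φ t‖ₑ * ‖trigPoly κ S (x - t)‖ₑ ∂periodMeasure := by
      rw [hconv, enorm_mul]
      have : ‖(2 * Real.pi : ℂ)⁻¹‖ₑ ≤ 1 := by
        rw [← ofReal_norm, ENNReal.ofReal_le_one, norm_inv, norm_mul, Complex.norm_ofNat, Complex.norm_real, Real.norm_eq_abs,
          abs_of_pos Real.pi_pos]
        exact inv_le_one_of_one_le₀ (by linarith [Real.pi_gt_three])
      calc _ ≤ 1 * ∫⁻ t, ‖(φ t : ℂ) * trigPoly κ S (x - t)‖ₑ ∂periodMeasure :=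
            mul_le_mul' this (enorm_integral_le_lintegral_enorm _)
        _ = _ := by
            rw [one_mul]
            refine lintegral_congr fun t => ?_
            rw [enorm_mul]
            congr 1
            rw [← ofReal_norm, ← ofReal_norm, Complex.norm_real]
    have h3 : ∫⁻ t, ‖φ t‖ₑ * ‖trigPoly κ S (x - t)‖ₑ ∂periodMeasure
        ≤ (∫⁻ t, ‖φ t‖ₑ * ‖trigPoly κ S (x - t)‖ₑ ^ s ∂periodMeasure) ^ (1 / s) := by
      -- Hölder with |φ| split as |φ|^(1/s') · |φ|^(1/s): this is Jensen's inequality for a measure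
      -- |φ| dt of mass at most 1. Tonelli and translation invariance then finish Young's
      -- inequality.
      have h4 := ENNReal.lintegral_mul_le_Lp_mul_Lq periodMeasure hq.symm
        (f := fun t => ‖φ t‖ₑ ^ (1 / (s / (s - 1))))
        (g := fun t => ‖φ t‖ₑ ^ (1 / s) * ‖trigPoly κ S (x - t)‖ₑ)
        (hφm.pow_const _) ((hφm.pow_const _).mul hKm)
      have hsum : 1 / (s / (s - 1)) + 1 / s = 1 := by
        have : s - 1 ≠ 0 := by linarith
        field_simp; ring
      have hq0 : 0 < s / (s - 1) := hq.symm.pos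
      have e1 : ∀ t, ((fun t => ‖φ t‖ₑ ^ (1 / (s / (s - 1)))) *
          (fun t => ‖φ t‖ₑ ^ (1 / s) * ‖trigPoly κ S (x - t)‖ₑ)) t
          = ‖φ t‖ₑ * ‖trigPoly κ S (x - t)‖ₑ := by
        intro t
        simp only [Pi.mul_apply]
        rw [← mul_assoc, ← ENNReal.rpow_add_of_nonneg _ _ (by positivity) (by positivity), hsum,
          ENNReal.rpow_one]
      have e2 : ∀ t, (‖φ t‖ₑ ^ (1 / (s / (s - 1)))) ^ (s / (s - 1)) = ‖φ t‖ₑ := by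
        intro t
        rw [← ENNReal.rpow_mul, one_div_mul_cancel hq0.ne', ENNReal.rpow_one]
      have e3 : ∀ t, (‖φ t‖ₑ ^ (1 / s) * ‖trigPoly κ S (x - t)‖ₑ) ^ s
          = ‖φ t‖ₑ * ‖trigPoly κ S (x - t)‖ₑ ^ s := by
        intro t
        rw [ENNReal.mul_rpow_of_nonneg _ _ hs0.le, ← ENNReal.rpow_mul,
          one_div_mul_cancel hs0.ne', ENNReal.rpow_one]
      simp only [e1, e2, e3] at h4
      refine h4.trans ?_
      calc _ ≤ 1 * _ := mul_le_mul_left (ENNReal.rpow_le_one hφ1' (by positivity)) _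
        _ = _ := one_mul _
    calc _ ≤ ((∫⁻ t, ‖φ t‖ₑ * ‖trigPoly κ S (x - t)‖ₑ ^ s ∂periodMeasure) ^ (1 / s)) ^ s :=
          ENNReal.rpow_le_rpow (h2.trans h3) hs0.le
      _ = _ := by rw [← ENNReal.rpow_mul, one_div_mul_cancel hs0.ne', ENNReal.rpow_one]
  have hsne : ENNReal.ofReal s ≠ 0 := by simpa using hs0
  rw [eLpNorm_eq_lintegral_rpow_enorm_toReal hsne ENNReal.ofReal_ne_top,
    eLpNorm_eq_lintegral_rpow_enorm_toReal hsne ENNReal.ofReal_ne_top,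
    ENNReal.toReal_ofReal hs0.le]
  refine ENNReal.rpow_le_rpow ?_ (by positivity)
  calc _ ≤ ∫⁻ x, ∫⁻ t, ‖φ t‖ₑ * ‖trigPoly κ S (x - t)‖ₑ ^ s ∂periodMeasure ∂periodMeasure :=
        lintegral_mono hpt
    _ = ∫⁻ t, ∫⁻ x, ‖φ t‖ₑ * ‖trigPoly κ S (x - t)‖ₑ ^ s ∂periodMeasure ∂periodMeasure := by
        refine lintegral_lintegral_swap ?_
        refine AEMeasurable.mul hφm.comp_snd ?_
        exact ((Continuous.enorm (by fun_prop)).measurable.pow_const s).aemeasurable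
    _ = ∫⁻ t, ‖φ t‖ₑ * ∫⁻ x, ‖trigPoly κ S x‖ₑ ^ s ∂periodMeasure ∂periodMeasure := by
        refine lintegral_congr fun t => ?_
        rw [lintegral_const_mul _
          ((Continuous.enorm (by fun_prop)).measurable.pow_const s),
          lintegral_enorm_rpow_sub hKc (periodic_trigPoly κ S) hs0]
    _ = (∫⁻ t, ‖φ t‖ₑ ∂periodMeasure) * ∫⁻ x, ‖trigPoly κ S x‖ₑ ^ s ∂periodMeasure :=
        lintegral_mul_const'' _ hφm
    _ ≤ 1 * ∫⁻ x, ‖trigPoly κ S x‖ₑ ^ s ∂periodMeasure := mul_le_mul_left hφ1' _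
    _ = _ := one_mul _

/-! ### L_s norms of peaked kernels and Abel summation -/

/-- Split at x = 1/λ: the flat part gives λ^s · λ⁻¹, and the tail of x^(-s) converges because s > 1.
-/
lemma lintegral_min_inv_rpow_le {s : ℝ} (hs : 1 < s) {lam : ℝ} (hl : 0 < lam) :
    ∫⁻ x in Ioi (0 : ℝ), ENNReal.ofReal ((min lam x⁻¹) ^ s)
      ≤ ENNReal.ofReal ((1 + 1 / (s - 1)) * lam ^ (s - 1)) := by
  have hs1 : 0 < s - 1 := by linarith
  have hli : 0 < lam⁻¹ := inv_pos.2 hl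
  rw [← Ioc_union_Ioi_eq_Ioi hli.le]
  refine (lintegral_union_le _ _ _).trans ?_
  have h1 : ∫⁻ x in Ioc 0 lam⁻¹, ENNReal.ofReal ((min lam x⁻¹) ^ s)
      ≤ ENNReal.ofReal (lam ^ (s - 1)) := by
    calc _ ≤ ∫⁻ _ in Ioc 0 lam⁻¹, ENNReal.ofReal (lam ^ s) := by
          refine setLIntegral_mono' measurableSet_Ioc fun x hx => ENNReal.ofReal_le_ofReal ?_
          exact Real.rpow_le_rpow (le_min hl.le (inv_nonneg.2 hx.1.le)) (min_le_left _ _)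
            (by linarith)
      _ = ENNReal.ofReal (lam ^ (s - 1)) := by
          rw [setLIntegral_const, Real.volume_Ioc, sub_zero, ← ENNReal.ofReal_mul (by positivity),
            Real.rpow_sub_one hl.ne']
          rfl
  have h2 : ∫⁻ x in Ioi lam⁻¹, ENNReal.ofReal ((min lam x⁻¹) ^ s)
      ≤ ENNReal.ofReal (1 / (s - 1) * lam ^ (s - 1)) := by
    calc _ ≤ ∫⁻ x in Ioi lam⁻¹, ENNReal.ofReal (x ^ (-s)) := by
          refine setLIntegral_mono' measurableSet_Ioi fun x hx => ENNReal.ofReal_le_ofReal ?_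
          have hx0 : 0 < x := hli.trans hx
          rw [Real.rpow_neg hx0.le, ← Real.inv_rpow hx0.le]
          exact Real.rpow_le_rpow (le_min hl.le (inv_nonneg.2 hx0.le)) (min_le_right _ _)
            (by linarith)
      _ = ENNReal.ofReal (1 / (s - 1) * lam ^ (s - 1)) := by
          rw [← ofReal_integral_eq_lintegral_ofReal
            (integrableOn_Ioi_rpow_of_lt (by linarith) hli), integral_Ioi_rpow_of_lt (by linarith) hli]
          · congr 1
            rw [Real.inv_rpow hl.le, ← Real.rpow_neg hl.le, show -(-s + 1) = s - 1 by ring,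
              show -s + 1 = -(s - 1) by ring]
            field_simp
          · exact (ae_restrict_iff' measurableSet_Ioi).2 (Eventually.of_forall fun x hx =>
              Real.rpow_nonneg (hli.trans hx).le _)
  refine (add_le_add h1 h2).trans (le_of_eq ?_)
  rw [← ENNReal.ofReal_add (by positivity) (by positivity)]
  congr 1; ring

/-- A kernel that is at most `D * min (lam, 1 / dist (x, 2πℤ))` has `L_s` norm of order
`D * lam ^ (1 - 1 / s)`. -/
lemma eLpNorm_le_of_peak {s : ℝ} (hs : 1 < s) {lam D : ℝ} (hl : 0 < lam) (hD : 0 ≤ D) {K : ℝ → ℂ}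
    (h1 : ∀ x, ‖K x‖ ≤ D * lam)
    (h2 : ∀ x ∈ Ioo 0 (2 * Real.pi), min x (2 * Real.pi - x) * ‖K x‖ ≤ D) :
    eLpNorm K (ENNReal.ofReal s) periodMeasure
      ≤ ENNReal.ofReal ((2 * (1 + 1 / (s - 1))) ^ (1 / s) * (D * lam ^ (1 - 1 / s))) := by
  have hs0 : 0 < s := one_pos.trans hs
  have hs1 : 0 < s - 1 := by linarith
  have hsne : ENNReal.ofReal s ≠ 0 := by simpa using hs0
  rw [eLpNorm_eq_lintegral_rpow_enorm_toReal hsne ENNReal.ofReal_ne_top,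
    ENNReal.toReal_ofReal hs0.le]
  set m : ℝ → ℝ≥0∞ := fun x => ENNReal.ofReal ((min lam x⁻¹) ^ s) with hm
  have hmm : Measurable m := by fun_prop
  have hpt : ∀ x ∈ Ioo 0 (2 * Real.pi),
      ‖K x‖ₑ ^ s ≤ ENNReal.ofReal (D ^ s) * (m x + m (2 * Real.pi - x)) := by
    intro x hx
    have aux : ∀ y : ℝ, 0 < y → y * ‖K x‖ ≤ D → ‖K x‖ₑ ^ s ≤ ENNReal.ofReal (D ^ s) * m y := by
      intro y hy hyD
      rw [← ofReal_norm, ENNReal.ofReal_rpow_of_nonneg (norm_nonneg _) hs0.le, hm,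
        ← ENNReal.ofReal_mul (by positivity), ← Real.mul_rpow hD (le_min hl.le (by positivity))]
      refine ENNReal.ofReal_le_ofReal (Real.rpow_le_rpow (norm_nonneg _) ?_ hs0.le)
      rw [mul_min_of_nonneg _ _ hD]
      refine le_min (h1 x) ?_
      rw [← div_eq_mul_inv, le_div_iff₀ hy]
      linarith
    have hmin := h2 x hx
    rw [mul_add]
    rcases le_total x (2 * Real.pi - x) with h | h
    · rw [min_eq_left h] at hmin
      exact (aux x hx.1 hmin).trans le_self_add
    · rw [min_eq_right h] at hmin
      exact (aux _ (by linarith [hx.2]) hmin).trans le_add_self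
  have hI : ∫⁻ x, ‖K x‖ₑ ^ s ∂periodMeasure
      ≤ ENNReal.ofReal (D ^ s * (2 * (1 + 1 / (s - 1)) * lam ^ (s - 1))) := by
    rw [periodMeasure, Measure.restrict_congr_set Ioo_ae_eq_Ico.symm]
    have hrefl : ∫⁻ x in Ioo 0 (2 * Real.pi), m (2 * Real.pi - x)
        = ∫⁻ x in Ioo 0 (2 * Real.pi), m x := by
      have hp := (Measure.measurePreserving_sub_left (volume : Measure ℝ)
        (2 * Real.pi)).setLIntegral_comp_preimage (s := Ioo 0 (2 * Real.pi)) measurableSet_Ioo hmm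
      rw [← hp]
      congr 2
      ext x; simp only [mem_preimage, mem_Ioo]; constructor <;> rintro ⟨a, b⟩ <;> constructor <;> linarith
    have hone : ∫⁻ x in Ioo 0 (2 * Real.pi), m x
        ≤ ENNReal.ofReal ((1 + 1 / (s - 1)) * lam ^ (s - 1)) :=
      (lintegral_mono_set Ioo_subset_Ioi_self).trans (lintegral_min_inv_rpow_le hs hl)
    calc _ ≤ ∫⁻ x in Ioo 0 (2 * Real.pi),
            ENNReal.ofReal (D ^ s) * (m x + m (2 * Real.pi - x)) :=
          setLIntegral_mono' measurableSet_Ioo hpt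
      _ = ENNReal.ofReal (D ^ s) * ((∫⁻ x in Ioo 0 (2 * Real.pi), m x)
            + ∫⁻ x in Ioo 0 (2 * Real.pi), m x) := by
          rw [lintegral_const_mul _ (by fun_prop), lintegral_add_left hmm, hrefl]
      _ ≤ ENNReal.ofReal (D ^ s) * (ENNReal.ofReal ((1 + 1 / (s - 1)) * lam ^ (s - 1))
            + ENNReal.ofReal ((1 + 1 / (s - 1)) * lam ^ (s - 1))) := by gcongr
      _ = _ := by
          rw [← ENNReal.ofReal_add (by positivity) (by positivity),
            ← ENNReal.ofReal_mul (by positivity)]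
          congr 1; ring
  refine (ENNReal.rpow_le_rpow hI (by positivity)).trans (le_of_eq ?_)
  rw [ENNReal.ofReal_rpow_of_nonneg (by positivity) (by positivity)]
  congr 1
  rw [Real.mul_rpow (by positivity) (by positivity), Real.mul_rpow (by positivity) (by positivity),
    ← Real.rpow_mul hD, ← Real.rpow_mul hl.le, mul_one_div_cancel hs0.ne', Real.rpow_one]
  rw [show (s - 1) * (1 / s) = 1 - 1 / s by field_simp]
  ring

/-- Jordan's inequality for the sine, applied on the side of π where x lies; it turns a factor |1 -
e^{ix}| into the distance to 2πℤ. -/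
lemma min_le_pi_div_two_mul_norm_one_sub_exp {x : ℝ} (hx : x ∈ Ioo 0 (2 * Real.pi)) :
    min x (2 * Real.pi - x) ≤ Real.pi / 2 * ‖1 - Complex.exp (Complex.I * x)‖ := by
  have hnorm : ‖1 - Complex.exp (Complex.I * x)‖ = 2 * Real.sin (x / 2) := by
    rw [norm_sub_rev, Complex.norm_exp_I_mul_ofReal_sub_one, norm_mul, Real.norm_ofNat,
      Real.norm_of_nonneg (Real.sin_nonneg_of_nonneg_of_le_pi (by linarith [hx.1])
        (by linarith [hx.2]))]
  rw [hnorm]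
  have hpi := Real.pi_pos
  have key : ∀ y : ℝ, 0 ≤ y → y ≤ Real.pi → y ≤ Real.pi / 2 * (2 * Real.sin (y / 2)) := by
    intro y h0 h1
    have := Real.mul_le_sin (x := y / 2) (by linarith) (by linarith)
    have h := mul_le_mul_of_nonneg_left this hpi.le
    field_simp at h ⊢
    linarith
  rcases le_total x Real.pi with h | h
  · exact (min_le_left _ _).trans (key x hx.1.le h)
  · refine (min_le_right _ _).trans ((key (2 * Real.pi - x) (by linarith [hx.2]) (by linarith)).trans
      (le_of_eq ?_))
    rw [show (2 * Real.pi - x) / 2 = Real.pi - x / 2 by ring, Real.sin_pi_sub]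

/-- Abel summation: multiplying by 1 - z leaves boundary terms and the increments of a, whose total
variation telescopes by monotonicity. -/
lemma norm_one_sub_mul_sum_le {a : ℕ → ℝ} {p M : ℕ} {B : ℝ}
    (h0 : ∀ k ∈ Icc p M, 0 ≤ a k) (hB : ∀ k ∈ Icc p M, a k ≤ B)
    (ha : MonotoneOn a (Icc p M) ∨ AntitoneOn a (Icc p M)) (hpM : p ≤ M) {z : ℂ} (hz : ‖z‖ = 1) :
    ‖(1 - z) * ∑ k ∈ Finset.Icc p M, (a k : ℂ) * z ^ k‖ ≤ 2 * B := by
  have hn : ∀ (c : ℝ) (k : ℕ), ‖(c : ℂ) * z ^ k‖ = |c| := by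
    intro c k
    rw [norm_mul, norm_pow, hz, one_pow, mul_one, Complex.norm_real, Real.norm_eq_abs]
  -- Adding the boundary term a_m z^(m+1) makes the induction clean: each step adds only the
  -- increment (a_(m+1) - a_m) z^(m+1).
  have main : ∀ m, p ≤ m → m ≤ M →
      ‖(1 - z) * ∑ k ∈ Finset.Icc p m, (a k : ℂ) * z ^ k + a m * z ^ (m + 1)‖ ≤ 2 * B - a m := by
    rcases ha with ha | ha
    · have : ∀ m, p ≤ m → m ≤ M →
          ‖(1 - z) * ∑ k ∈ Finset.Icc p m, (a k : ℂ) * z ^ k + a m * z ^ (m + 1)‖ ≤ a m := by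
        intro m hm
        induction m, hm using Nat.le_induction with
        | base =>
          intro hM
          rw [Finset.Icc_self, Finset.sum_singleton]
          rw [show (1 - z) * ((a p : ℂ) * z ^ p) + a p * z ^ (p + 1) = (a p : ℂ) * z ^ p by ring, hn,
            abs_of_nonneg (h0 p ⟨le_rfl, hM⟩)]
        | succ m hm ih =>
          intro hM
          have hle := ha ⟨hm, by omega⟩ ⟨by omega, hM⟩ (Nat.le_succ m)
          rw [Finset.sum_Icc_succ_top (by omega)]
          rw [show (1 - z) * (∑ k ∈ Finset.Icc p m, (a k : ℂ) * z ^ k + a (m + 1) * z ^ (m + 1))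
              + a (m + 1) * z ^ (m + 1 + 1)
            = ((1 - z) * ∑ k ∈ Finset.Icc p m, (a k : ℂ) * z ^ k + a m * z ^ (m + 1))
              + ((a (m + 1) - a m : ℝ) : ℂ) * z ^ (m + 1) by push_cast; ring]
          refine (norm_add_le _ _).trans ?_
          rw [hn, abs_of_nonneg (by simpa using hle)]
          linarith [ih (by omega)]
      intro m hm hM
      linarith [this m hm hM, hB m ⟨hm, hM⟩]
    · have : ∀ m, p ≤ m → m ≤ M →
          ‖(1 - z) * ∑ k ∈ Finset.Icc p m, (a k : ℂ) * z ^ k + a m * z ^ (m + 1)‖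
            ≤ 2 * a p - a m := by
        intro m hm
        induction m, hm using Nat.le_induction with
        | base =>
          intro hM
          rw [Finset.Icc_self, Finset.sum_singleton]
          rw [show (1 - z) * ((a p : ℂ) * z ^ p) + a p * z ^ (p + 1) = (a p : ℂ) * z ^ p by ring, hn,
            abs_of_nonneg (h0 p ⟨le_rfl, hM⟩)]
          linarith
        | succ m hm ih =>
          intro hM
          have hle := ha ⟨hm, by omega⟩ ⟨by omega, hM⟩ (Nat.le_succ m)
          rw [Finset.sum_Icc_succ_top (by omega)]
          rw [show (1 - z) * (∑ k ∈ Finset.Icc p m, (a k : ℂ) * z ^ k + a (m + 1) * z ^ (m + 1))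
              + a (m + 1) * z ^ (m + 1 + 1)
            = ((1 - z) * ∑ k ∈ Finset.Icc p m, (a k : ℂ) * z ^ k + a m * z ^ (m + 1))
              + ((a (m + 1) - a m : ℝ) : ℂ) * z ^ (m + 1) by push_cast; ring]
          refine (norm_add_le _ _).trans ?_
          rw [hn, abs_of_nonpos (by simpa using hle)]
          linarith [ih (by omega)]
      intro m hm hM
      linarith [this m hm hM, hB p ⟨le_rfl, hpM⟩]
  have h := main M hpM le_rfl
  have h3 : (1 - z) * ∑ k ∈ Finset.Icc p M, (a k : ℂ) * z ^ k
      = ((1 - z) * ∑ k ∈ Finset.Icc p M, (a k : ℂ) * z ^ k + a M * z ^ (M + 1))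
        - a M * z ^ (M + 1) := by ring
  rw [h3]
  refine (norm_sub_le _ _).trans ?_
  rw [hn, abs_of_nonneg (h0 M ⟨hpM, le_rfl⟩)]
  linarith

/-- Dirichlet-type bound for a one-sided cosine-sine sum with monotone coefficients. -/
lemma min_mul_norm_sum_le {a : ℕ → ℝ} {p M : ℕ} {B : ℝ} (hB0 : 0 ≤ B)
    (h0 : ∀ k ∈ Icc p M, 0 ≤ a k) (hB : ∀ k ∈ Icc p M, a k ≤ B)
    (ha : MonotoneOn a (Icc p M) ∨ AntitoneOn a (Icc p M)) {x : ℝ} (hx : x ∈ Ioo 0 (2 * Real.pi)) :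
    min x (2 * Real.pi - x) * ‖∑ k ∈ Finset.Icc p M, (a k : ℂ) * Complex.exp (Complex.I * x) ^ k‖
      ≤ Real.pi * B := by
  rcases le_or_gt p M with hpM | hpM
  · have hz : ‖Complex.exp (Complex.I * x)‖ = 1 := by
      simp [mul_comm Complex.I, Complex.norm_exp_ofReal_mul_I]
    have h := norm_one_sub_mul_sum_le h0 hB ha hpM hz
    rw [norm_mul] at h
    calc _ ≤ (Real.pi / 2 * ‖1 - Complex.exp (Complex.I * x)‖) *
          ‖∑ k ∈ Finset.Icc p M, (a k : ℂ) * Complex.exp (Complex.I * x) ^ k‖ :=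
          mul_le_mul_of_nonneg_right (min_le_pi_div_two_mul_norm_one_sub_exp hx) (norm_nonneg _)
      _ ≤ Real.pi / 2 * (2 * B) := by
          rw [mul_assoc]
          exact mul_le_mul_of_nonneg_left h (by positivity)
      _ = _ := by ring
  · rw [Finset.Icc_eq_empty (by omega), Finset.sum_empty, norm_zero, mul_zero]
    positivity

/-! ### Decay of ψ: tail sums and sums of reciprocals -/

section Psi

variable {ψ : ℝ → ℝ}

/-- If ψ rose anywhere, convexity would keep its slopes positive from there on, contradicting the
limit 0. -/
lemma antitoneOn_of_mem_classM (hψ : ψ ∈ classM) : AntitoneOn ψ (Ici 1) := by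
  obtain ⟨hpos, hconv, -, hlim⟩ := hψ
  intro x hx y hy hxy
  rcases hxy.eq_or_lt with rfl | hlt
  · exact le_rfl
  by_contra! h
  have hev := hlim.eventually (gt_mem_nhds (hpos y hy))
  obtain ⟨z, hz1, hz2⟩ := (hev.and (eventually_gt_atTop y)).exists
  have hs := hconv.slope_mono_adjacent hx (show z ∈ Ici 1 from le_trans hy hz2.le) hlt hz2
  have h1 : 0 < (ψ y - ψ x) / (y - x) := div_pos (by linarith) (by linarith)
  have h2 : (ψ z - ψ y) / (z - y) < 0 := div_neg_of_neg_of_pos (by linarith) (by linarith)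
  linarith

lemma eta_spec (hψ : ψ ∈ classM) {t : ℝ} (ht : 1 ≤ t) : 1 ≤ eta ψ t ∧ ψ (eta ψ t) = ψ t / 2 := by
  have hanti := antitoneOn_of_mem_classM hψ
  obtain ⟨hpos, -, hcont, hlim⟩ := hψ
  have ht0 := hpos t ht
  obtain ⟨z, hz1, hz2⟩ := ((hlim.eventually (gt_mem_nhds (half_pos ht0))).and
    (eventually_gt_atTop t)).exists
  have hIVT := intermediate_value_Icc' hz2.le
    (hcont.mono fun y hy => (le_trans ht hy.1 : (1 : ℝ) ≤ y))
  obtain ⟨y, hy, hyt⟩ := hIVT ⟨hz1.le, by linarith⟩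
  have hex : ∃ a ∈ Ici (1 : ℝ), ψ a = ψ t / 2 := ⟨y, le_trans ht hy.1, hyt⟩
  exact ⟨Function.invFunOn_mem hex, Function.invFunOn_eq hex⟩

/-- Since t + K ≤ η(t), a step of length K at most halves ψ. This rules out a sudden drop caused by
rounding η(n) up to an integer. -/
lemma half_pow_mul_le (hψ : ψ ∈ classM) {K : ℝ} (hK0 : 0 < K)
    (hK : ∀ t, 1 ≤ t → K ≤ eta ψ t - t) {t : ℝ} (ht : 1 ≤ t) (j : ℕ) :
    ψ t ≤ 2 ^ j * ψ (t + j * K) := by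
  induction j with
  | zero => simp
  | succ j ih =>
    have ht' : 1 ≤ t + j * K := by nlinarith [mul_nonneg (Nat.cast_nonneg (α := ℝ) j) hK0.le]
    obtain ⟨h1, h2⟩ := eta_spec hψ ht'
    have h3 : ψ (eta ψ (t + j * K)) ≤ ψ (t + j * K + K) :=
      antitoneOn_of_mem_classM hψ (show (1 : ℝ) ≤ _ by linarith) h1 (by linarith [hK _ ht'])
    rw [h2] at h3
    have e : t + ((j + 1 : ℕ) : ℝ) * K = t + j * K + K := by push_cast; ring
    rw [e, pow_succ]
    have : (0 : ℝ) < 2 ^ j := by positivity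
    nlinarith

/-- Tail sums of `ψ` are controlled by `ψ(n) (η(n) - n)`. -/
lemma exists_sum_Ico_le (hψ : ψ ∈ classMTwo) :
    ∃ C : ℝ, 0 < C ∧ ∀ n : ℕ, 1 ≤ n → ∀ N : ℕ,
      ∑ k ∈ Finset.Ico n N, ψ k ≤ C * (ψ n * (eta ψ n - n)) := by
  obtain ⟨⟨hM, hmono, hlim⟩, K, hK0, hK⟩ := hψ
  have hanti := antitoneOn_of_mem_classM hM
  have hpos := hM.1
  have cast1 : ∀ {n : ℕ}, 1 ≤ n → (1 : ℝ) ≤ n := fun h => by exact_mod_cast h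
  -- With μ ≥ 4 and n ≥ 4, the next point n' = ⌈η(n)⌉ satisfies n' ≤ n + n/4 + 1 ≤ 3n/2.
  obtain ⟨t₀, ht₀⟩ := (hlim.eventually_ge_atTop 4).exists_forall_of_atTop
  obtain ⟨n₀, hn₀⟩ := exists_nat_ge (max t₀ 4)
  have hn₀t : t₀ ≤ n₀ := (le_max_left _ _).trans hn₀
  have hn₀4 : (4 : ℝ) ≤ n₀ := (le_max_right _ _).trans hn₀
  set C := 4 * (1 + 1 / K) with hC
  have hC0 : 0 < C := by positivity
  have trivial_sum : ∀ n : ℕ, 1 ≤ n → ∀ N : ℕ, ∑ k ∈ Finset.Ico n N, ψ k ≤ (N - n : ℕ) * ψ n := by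
    intro n hn N
    calc _ ≤ ∑ k ∈ Finset.Ico n N, ψ n := Finset.sum_le_sum fun k hk => by
          rw [Finset.mem_Ico] at hk
          exact hanti (cast1 hn) (cast1 (hn.trans hk.1)) (by exact_mod_cast hk.1)
      _ = _ := by rw [Finset.sum_const, Nat.card_Ico, nsmul_eq_mul]
  -- Passing from n to n' = ⌈η(n)⌉ halves ψ and, as μ is nondecreasing, multiplies the gap by at
  -- most n'/n ≤ 3/2. The tail thus uses 3/4 of the bound, and C is chosen so that the head fits in
  -- the remaining quarter.
  have large : ∀ d n N : ℕ, N - n ≤ d → n₀ ≤ n →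
      ∑ k ∈ Finset.Ico n N, ψ k ≤ C * (ψ n * (eta ψ n - n)) := by
    intro d
    induction d with
    | zero =>
      intro n N hN hn
      have hn4 : (4 : ℝ) ≤ n := hn₀4.trans (by exact_mod_cast hn)
      rw [Finset.Ico_eq_empty (by omega), Finset.sum_empty]
      have := hK n (by linarith)
      have := hpos n (by linarith)
      exact mul_nonneg hC0.le (mul_nonneg this.le (by linarith))
    | succ d ih =>
      intro n N hN hn
      have hn4 : (4 : ℝ) ≤ n := hn₀4.trans (by exact_mod_cast hn)
      have hn1 : (1 : ℝ) ≤ n := by linarith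
      have hL := hK n hn1
      have hψn := hpos n hn1
      obtain ⟨he1, he2⟩ := eta_spec hM hn1
      set L := eta ψ n - n with hLdef
      have hL0 : 0 < L := hK0.trans_le hL
      set n' := ⌈eta ψ n⌉₊ with hn'
      have hn'1 : eta ψ n ≤ n' := Nat.le_ceil _
      have hn'2 : (n' : ℝ) < eta ψ n + 1 := Nat.ceil_lt_add_one (by linarith)
      have hnn' : n < n' := by
        have : (n : ℝ) < n' := by linarith
        exact_mod_cast this
      have hmu : 4 ≤ mu ψ n := ht₀ n (hn₀t.trans (by exact_mod_cast hn))
      have hmu' : mu ψ n ≤ mu ψ n' := hmono hn1 (show (1 : ℝ) ≤ n' by linarith)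
        (by exact_mod_cast hnn'.le)
      have hL' := hK n' (by linarith)
      set L' := eta ψ n' - n' with hL'def
      have hL'0 : 0 < L' := hK0.trans_le hL'
      have hLn : 4 * L ≤ n := by
        rw [mu, ← hLdef, le_div_iff₀ hL0] at hmu
        exact hmu
      have hcross : n * L' ≤ n' * L := by
        rw [mu, mu, ← hLdef, ← hL'def, div_le_div_iff₀ hL0 hL'0] at hmu'
        exact hmu'
      have hL'le : L' ≤ 3 / 2 * L := by
        have h1 : (n' : ℝ) ≤ 3 / 2 * n := by linarith
        have h2 : n * L' ≤ n * (3 / 2 * L) := by nlinarith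
        exact le_of_mul_le_mul_left h2 (by linarith)
      have hψn' : ψ n' ≤ ψ n / 2 := by
        rw [← he2]
        exact hanti he1 (show (1 : ℝ) ≤ n' by linarith) hn'1
      have hψn'0 := hpos n' (by linarith)
      have htail : ∑ k ∈ Finset.Ico n' N, ψ k ≤ C * (ψ n * L) * (3 / 4) := by
        refine (ih n' N (by omega) (by omega)).trans ?_
        have : ψ n' * L' ≤ ψ n / 2 * (3 / 2 * L) := mul_le_mul hψn' hL'le hL'0.le (by linarith)
        nlinarith
      have hhead : ∑ k ∈ Finset.Ico n n', ψ k ≤ C * (ψ n * L) / 4 := by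
        refine (trivial_sum n (by exact_mod_cast hn1) n').trans ?_
        rw [Nat.cast_sub hnn'.le]
        have h1 : (n' : ℝ) - n ≤ (1 + 1 / K) * L := by
          have : 1 ≤ 1 / K * L := by
            rw [one_div, ← div_eq_inv_mul, le_div_iff₀ hK0]; linarith
          linarith
        have := mul_le_mul_of_nonneg_right h1 hψn.le
        rw [hC]; linarith
      have hsplit : ∑ k ∈ Finset.Ico n N, ψ k
          ≤ ∑ k ∈ Finset.Ico n n', ψ k + ∑ k ∈ Finset.Ico n' N, ψ k := by
        have hnn : ∀ k ∈ Finset.Ico n (max n' N), 0 ≤ ψ (k : ℝ) := fun k hk => by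
          rw [Finset.mem_Ico] at hk
          exact (hpos k (hn1.trans (by exact_mod_cast hk.1))).le
        rcases le_total n' N with h | h
        · rw [Finset.sum_Ico_consecutive _ hnn'.le h]
        · rw [Finset.Ico_eq_empty_of_le h, Finset.sum_empty, add_zero]
          refine Finset.sum_le_sum_of_subset_of_nonneg (Finset.Ico_subset_Ico_right h) fun k hk _ => ?_
          rw [max_eq_left h] at hnn
          exact hnn k hk
      linarith
  have hn₀1 : (1 : ℝ) ≤ n₀ := by linarith
  have hL₀ := hK n₀ hn₀1
  set L₀ := eta ψ n₀ - n₀ with hL₀def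
  have hL₀0 : 0 < L₀ := hK0.trans_le hL₀
  -- The two extra terms serve n < n₀: finitely many summands, each at most ψ(n), and the tail from
  -- n₀. Both are compared with ψ(n)L using L ≥ K.
  refine ⟨C + n₀ / K + C * L₀ / K, by positivity, fun n hn N => ?_⟩
  have hn1 := cast1 hn
  have hL := hK n hn1
  have hψn := hpos n hn1
  set L := eta ψ n - n with hLdef
  have hL0 : 0 < L := hK0.trans_le hL
  rcases le_or_gt n₀ n with h | h
  · refine (large (N - n) n N le_rfl h).trans ?_
    have : 0 ≤ (n₀ / K + C * L₀ / K) * (ψ n * L) := by positivity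
    nlinarith
  · have h1 := trivial_sum n hn n₀
    have h2 := large (N - n₀) n₀ N le_rfl le_rfl
    have hψ₀ : ψ n₀ ≤ ψ n := hanti hn1 hn₀1 (by exact_mod_cast h.le)
    have hnn : ∀ k : ℕ, n ≤ k → 0 ≤ ψ (k : ℝ) := fun k hk =>
      (hpos k (hn1.trans (by exact_mod_cast hk))).le
    have hsplit : ∑ k ∈ Finset.Ico n N, ψ k
          ≤ ∑ k ∈ Finset.Ico n n₀, ψ k + ∑ k ∈ Finset.Ico n₀ N, ψ k := by
      rcases le_total n₀ N with h' | h'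
      · rw [Finset.sum_Ico_consecutive _ h.le h']
      · rw [Finset.Ico_eq_empty_of_le h', Finset.sum_empty, add_zero]
        exact Finset.sum_le_sum_of_subset_of_nonneg (Finset.Ico_subset_Ico_right h')
          fun k hk _ => hnn k (Finset.mem_Ico.1 hk).1
    have h1L : 1 ≤ L / K := by rw [le_div_iff₀ hK0]; linarith
    have h3 : ((n₀ - n : ℕ) : ℝ) * ψ n ≤ n₀ / K * (ψ n * L) := by
      have : ((n₀ - n : ℕ) : ℝ) ≤ n₀ := by exact_mod_cast Nat.sub_le _ _
      calc _ ≤ (n₀ : ℝ) * ψ n * 1 := by rw [mul_one]; gcongr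
        _ ≤ n₀ * ψ n * (L / K) := by gcongr
        _ = _ := by ring
    have h4 : C * (ψ n₀ * L₀) ≤ C * L₀ / K * (ψ n * L) := by
      calc _ ≤ C * (ψ n * L₀) * 1 := by rw [mul_one]; gcongr
        _ ≤ C * (ψ n * L₀) * (L / K) := by gcongr
        _ = _ := by ring
    have h5 : 0 ≤ C * (ψ n * L) := by positivity
    linarith

/-- By convexity the right derivative is at most the slope of the chord from t to η(t), over which ψ
drops by exactly half. Consequently ψ/|ψ'| ≤ 2(η(t) - t). -/
lemma rightDeriv_le_neg (hψ : ψ ∈ classM) {t : ℝ} (ht : 1 < t) (hL : 0 < eta ψ t - t) :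
    derivWithin ψ (Ioi t) t ≤ -(ψ t / 2) / (eta ψ t - t) := by
  obtain ⟨h1, h2⟩ := eta_spec hψ ht.le
  have := hψ.2.1.rightDeriv_le_slope_of_mem_interior
    (show t ∈ interior (Ici 1) by rw [interior_Ici]; exact ht) h1 (by linarith)
  rw [slope_def_field, h2] at this
  refine this.trans (le_of_eq ?_)
  congr 1; ring

lemma slope_le_rightDeriv_of_convex (hψ : ψ ∈ classM) {x t : ℝ} (hx : 1 ≤ x) (hxt : x < t) :
    (ψ t - ψ x) / (t - x) ≤ derivWithin ψ (Ioi t) t := by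
  rw [hψ.2.1.rightDeriv_eq_sInf_slope_of_mem_interior
    (show t ∈ interior (Ici 1) by rw [interior_Ici]; exact hx.trans_lt hxt)]
  refine le_csInf ⟨_, t + 1, ⟨show (1 : ℝ) ≤ t + 1 by linarith, by linarith⟩, rfl⟩ ?_
  rintro _ ⟨y, ⟨hy1, hy2⟩, rfl⟩
  rw [slope_def_field]
  exact hψ.2.1.slope_mono_adjacent hx hy1 hxt hy2

/-- Sums of `1 / ψ` up to slightly beyond `η(n)` are controlled by `(η(n) - n) / ψ(n)`. -/
lemma exists_sum_inv_le (hψ : ψ ∈ classMTwo) (hratio : IncreasesToInfinity (decayRatio ψ)) :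
    ∃ C : ℝ, 0 < C ∧ ∀ n : ℕ, 1 ≤ n →
      ψ n ≤ C * ψ (n + ⌈eta ψ n - n⌉₊ : ℕ) ∧
      ∑ k ∈ Finset.Icc 1 (n + ⌈eta ψ n - n⌉₊), ψ n / ψ k ≤ C * (eta ψ n - n) := by
  obtain ⟨⟨hM, -, -⟩, K, hK0, hK⟩ := hψ
  obtain ⟨⟨T, hT⟩, -⟩ := hratio
  have hanti := antitoneOn_of_mem_classM hM
  have hpos := hM.1
  have cast1 : ∀ {n : ℕ}, 1 ≤ n → (1 : ℝ) ≤ n := fun h => by exact_mod_cast h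
  -- Here j steps of length K cover the rounding error 1 in N ≤ η(n) + 1, so ψ(n) = 2ψ(η(n)) ≤
  -- 2^(j+1) ψ(N).
  obtain ⟨j, hj⟩ := exists_nat_ge (1 / K)
  rw [div_le_iff₀ hK0] at hj
  obtain ⟨τ, hτ⟩ := exists_nat_ge (max T 2)
  have hτT : T ≤ τ := (le_max_left _ _).trans hτ
  have hτ2 : 2 ≤ τ := by exact_mod_cast (le_max_right _ _).trans hτ
  have trivial_sum : ∀ a b N : ℕ, 1 ≤ a → b ≤ N + 1 → 1 ≤ N → ∀ c, 0 ≤ c →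
      ∑ k ∈ Finset.Ico a b, c / ψ k ≤ (b - a : ℕ) * (c / ψ N) := by
    intro a b N ha hb hN c hc
    calc _ ≤ ∑ k ∈ Finset.Ico a b, c / ψ N := Finset.sum_le_sum fun k hk => by
          rw [Finset.mem_Ico] at hk
          exact div_le_div_of_nonneg_left hc (hpos N (cast1 hN))
            (hanti (cast1 (ha.trans hk.1)) (cast1 hN) (by exact_mod_cast (by omega : k ≤ N)))
      _ = _ := by rw [Finset.sum_const, Nat.card_Ico, nsmul_eq_mul]
  -- A discrete differential inequality: for τ ≤ m < n, monotonicity bounds ψ/|ψ'| at m + 1 by its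
  -- value at n, at most 2L. Convexity then gives ψ(m+1) ≤ 2L(ψ(m) - ψ(m+1)), that is, 1/ψ(m) ≤
  -- 2L(1/ψ(m+1) - 1/ψ(m)), which telescopes.
  have tele : ∀ n : ℕ, τ ≤ n → ∀ m, τ ≤ m → m ≤ n →
      ∑ k ∈ Finset.Ico τ m, 1 / ψ k ≤ 2 * (eta ψ n - n) * (1 / ψ m) := by
    intro n hn
    have hn1 : (1 : ℝ) < n := by exact_mod_cast (by omega : 1 < n)
    have hL : 0 < eta ψ n - n := hK0.trans_le (hK n hn1.le)
    intro m hm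
    induction m, hm using Nat.le_induction with
    | base =>
      intro _
      rw [Finset.Ico_self, Finset.sum_empty]
      have := hpos τ (by exact_mod_cast (by omega : 1 ≤ τ))
      positivity
    | succ m hm ih =>
      intro hmn
      have ih := ih (by omega)
      rw [Finset.sum_Ico_succ_top (by omega)]
      have hm1 : (1 : ℝ) < m := by exact_mod_cast (by omega : 1 < m)
      have hψm := hpos m hm1.le
      have hψm' := hpos (m + 1 : ℕ) (by push_cast; linarith)
      have hderiv : ∀ t : ℝ, 1 < t → 0 < -derivWithin ψ (Ioi t) t ∧ decayRatio ψ t ≤ 2 * (eta ψ t - t) := by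
        intro t ht
        have hLt : 0 < eta ψ t - t := hK0.trans_le (hK t ht.le)
        have h := rightDeriv_le_neg hM ht hLt
        have hψt := hpos t ht.le
        have hd : 0 < ψ t / 2 / (eta ψ t - t) := by positivity
        rw [neg_div] at h
        have hneg : 0 < -derivWithin ψ (Ioi t) t := by linarith
        refine ⟨hneg, ?_⟩
        rw [decayRatio, ← abs_neg, abs_of_pos hneg, div_le_iff₀ hneg]
        have h' : ψ t / 2 / (eta ψ t - t) ≤ -derivWithin ψ (Ioi t) t := by linarith
        rw [div_le_iff₀ hLt] at h'
        linarith
      have hr1 : decayRatio ψ (m + 1 : ℕ) ≤ decayRatio ψ n :=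
        hT (show T ≤ ((m + 1 : ℕ) : ℝ) from hτT.trans (by exact_mod_cast (by omega : τ ≤ m + 1)))
          (show T ≤ (n : ℝ) from hτT.trans (by exact_mod_cast hn)) (by exact_mod_cast hmn)
      have hr2 := hr1.trans (hderiv n hn1).2
      have hd := (hderiv (m + 1 : ℕ) (by push_cast; linarith)).1
      rw [decayRatio, ← abs_neg, abs_of_pos hd, div_le_iff₀ hd] at hr2
      have hsl := slope_le_rightDeriv_of_convex hM (x := m) (t := (m + 1 : ℕ)) hm1.le
        (by push_cast; linarith)
      have e : ((m + 1 : ℕ) : ℝ) - m = 1 := by push_cast; ring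
      rw [e, div_one] at hsl
      set d := -derivWithin ψ (Ioi ((m + 1 : ℕ) : ℝ)) ((m + 1 : ℕ) : ℝ) with hdd
      set L2 := 2 * (eta ψ n - n) with hL2
      have hfin : ψ (m + 1 : ℕ) ≤ L2 * (ψ m - ψ (m + 1 : ℕ)) :=
        hr2.trans (mul_le_mul_of_nonneg_left (by linarith) (by positivity))
      have : 1 / ψ m ≤ L2 * (1 / ψ (m + 1 : ℕ)) - L2 * (1 / ψ m) := by
        rw [← mul_sub, div_sub_div _ _ hψm'.ne' hψm.ne', mul_div_assoc', div_le_div_iff₀ hψm (by positivity)]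
        nlinarith
      linarith
  set C₀ : ℝ := 2 ^ (j + 1) with hC₀
  have hC₀0 : 0 < C₀ := by positivity
  -- The contributions are τ/K for indices below τ, 2 from the telescoping range, and C₀(1 + 2/K)
  -- for the ⌈L⌉ + 1 indices from n to N.
  refine ⟨C₀ + (τ / K + 2 + C₀ * (1 + 2 / K)), by positivity, fun n hn => ?_⟩
  have hn1 := cast1 hn
  have hL := hK n hn1
  have hψn := hpos n hn1
  obtain ⟨he1, he2⟩ := eta_spec hM hn1
  set L := eta ψ n - n with hLdef
  have hL0 : 0 < L := hK0.trans_le hL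
  set N := n + ⌈L⌉₊ with hN
  have hceil : (⌈L⌉₊ : ℝ) < L + 1 := Nat.ceil_lt_add_one hL0.le
  have hN1 : (N : ℝ) ≤ eta ψ n + 1 := by rw [hN]; push_cast; linarith
  have hNn : 1 ≤ N := by omega
  have hψN := hpos N (cast1 hNn)
  have hC : ψ n ≤ C₀ * ψ N := by
    have h1 := half_pow_mul_le hM hK0 hK he1 j
    have h2 : ψ (eta ψ n + j * K) ≤ ψ N :=
      hanti (cast1 hNn) (show (1 : ℝ) ≤ eta ψ n + j * K by linarith) (by linarith)
    rw [he2] at h1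
    have h3 : (0 : ℝ) < 2 ^ j := by positivity
    rw [hC₀, pow_succ]
    nlinarith
  have h1L : 1 ≤ L / K := by rw [le_div_iff₀ hK0]; linarith
  refine ⟨hC.trans (mul_le_mul_of_nonneg_right ?_ hψN.le), ?_⟩
  · have : 0 ≤ τ / K + 2 + C₀ * (1 + 2 / K) := by positivity
    linarith
  have hsplit : ∑ k ∈ Finset.Icc 1 N, ψ n / ψ k
      = ∑ k ∈ Finset.Ico 1 n, ψ n / ψ k + ∑ k ∈ Finset.Ico n (N + 1), ψ n / ψ k := by
    rw [Finset.sum_Ico_consecutive _ hn (by omega)]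
    rfl
  have htop : ∑ k ∈ Finset.Ico n (N + 1), ψ n / ψ k ≤ C₀ * (1 + 2 / K) * L := by
    refine (trivial_sum n (N + 1) N hn le_rfl hNn _ hψn.le).trans ?_
    have h1 : ψ n / ψ N ≤ C₀ := by rw [div_le_iff₀ hψN]; exact hC
    have h2 : ((N + 1 - n : ℕ) : ℝ) ≤ (1 + 2 / K) * L := by
      rw [show N + 1 - n = ⌈L⌉₊ + 1 by omega]
      push_cast
      have : 2 / K * L = 2 * (L / K) := by ring
      linarith
    calc _ ≤ (1 + 2 / K) * L * C₀ := mul_le_mul h2 h1 (by positivity) (by positivity)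
      _ = _ := by ring
  have hτL : (τ : ℝ) ≤ τ / K * L := by
    calc (τ : ℝ) = τ * 1 := (mul_one _).symm
      _ ≤ τ * (L / K) := by gcongr
      _ = _ := by ring
  have hlow : ∑ k ∈ Finset.Ico 1 n, ψ n / ψ k ≤ (τ / K + 2) * L := by
    rcases le_total n τ with h | h
    · refine (trivial_sum 1 n n le_rfl (by omega) hn _ hψn.le).trans ?_
      rw [div_self hψn.ne', mul_one]
      have : ((n - 1 : ℕ) : ℝ) ≤ τ := by exact_mod_cast (by omega : n - 1 ≤ τ)
      linarith
    · rw [← Finset.sum_Ico_consecutive _ (by omega : 1 ≤ τ) h]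
      have h1 := trivial_sum 1 τ n le_rfl (by omega) hn _ hψn.le
      rw [div_self hψn.ne', mul_one] at h1
      have h2 : ((τ - 1 : ℕ) : ℝ) ≤ τ := by exact_mod_cast (by omega : τ - 1 ≤ τ)
      have h3 := mul_le_mul_of_nonneg_left (tele n h n h le_rfl) hψn.le
      rw [Finset.mul_sum, ← hLdef] at h3
      have h4 : ψ n * (2 * L * (1 / ψ n)) = 2 * L := by field_simp
      have h5 : ∑ k ∈ Finset.Ico τ n, ψ n / ψ k = ∑ k ∈ Finset.Ico τ n, ψ n * (1 / ψ k) :=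
        Finset.sum_congr rfl fun k _ => by ring
      linarith
  have : 0 ≤ C₀ * L := by positivity
  linarith

end Psi

/-! ### Two-sided kernels with phases -/

/-- The symbol `a(|k|) e^{-i (βπ/2) sign k}`. -/
noncomputable def phaseMul (β : ℝ) (a : ℕ → ℝ) (k : ℤ) : ℂ :=
  (a k.natAbs : ℂ) * Complex.exp (-(Complex.I * ((β * Real.pi / 2 * (k.sign : ℝ) : ℝ) : ℂ)))

lemma sum_Icc_natCast (F : ℤ → ℂ) (p M : ℕ) :
    ∑ k ∈ Finset.Icc (p : ℤ) M, F k = ∑ k ∈ Finset.Icc p M, F (k : ℤ) := by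
  refine Finset.sum_nbij' Int.toNat Nat.cast ?_ ?_ ?_ ?_ ?_ <;> intro k hk <;>
    simp only [Finset.mem_Icc] at hk ⊢ <;> first | omega | skip
  rw [Int.toNat_of_nonneg (by omega)]

lemma sum_Icc_neg_natCast (F : ℤ → ℂ) (q M : ℕ) :
    ∑ k ∈ Finset.Icc (-M : ℤ) (-q), F k = ∑ k ∈ Finset.Icc q M, F (-(k : ℤ)) := by
  refine Finset.sum_nbij' (fun k => (-k).toNat) (fun k => -(k : ℤ)) ?_ ?_ ?_ ?_ ?_ <;> intro k hk <;>
    simp only [Finset.mem_Icc] at hk ⊢ <;> first | omega | skip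
  rw [Int.toNat_of_nonneg (by omega), neg_neg]

/-- The frequencies `p ≤ k ≤ M` and `-M ≤ k ≤ -q`. -/
noncomputable def band (p q M : ℕ) : Finset ℤ := Finset.Icc (p : ℤ) M ∪ Finset.Icc (-M : ℤ) (-q)

lemma disjoint_band {p q : ℕ} (hp : 1 ≤ p) (M : ℕ) :
    Disjoint (Finset.Icc (p : ℤ) M) (Finset.Icc (-M : ℤ) (-q)) := by
  rw [Finset.disjoint_left]
  intro k hk hk'
  rw [Finset.mem_Icc] at hk hk'
  omega

lemma sum_band (F : ℤ → ℂ) {p : ℕ} (hp : 1 ≤ p) (q M : ℕ) :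
    ∑ k ∈ band p q M, F k
      = ∑ k ∈ Finset.Icc p M, F (k : ℤ) + ∑ k ∈ Finset.Icc q M, F (-(k : ℤ)) := by
  rw [band, Finset.sum_union (disjoint_band hp M), sum_Icc_natCast, sum_Icc_neg_natCast]

/-- On each side of 0 the phase is a constant of modulus 1, and the negative frequencies give a
conjugated one-sided sum; β therefore drops out. -/
lemma norm_trigPoly_band_le (β : ℝ) (a : ℕ → ℝ) {p q : ℕ} (hp : 1 ≤ p) (hq : 1 ≤ q) (M : ℕ) (x : ℝ) :
    ‖trigPoly (phaseMul β a) (band p q M) x‖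
      ≤ ‖∑ k ∈ Finset.Icc p M, (a k : ℂ) * Complex.exp (Complex.I * x) ^ k‖
        + ‖∑ k ∈ Finset.Icc q M, (a k : ℂ) * Complex.exp (Complex.I * x) ^ k‖ := by
  have hphase : ∀ r : ℝ, ‖Complex.exp (-(Complex.I * (r : ℂ)))‖ = 1 := by
    intro r
    rw [show -(Complex.I * (r : ℂ)) = ((-r : ℝ) : ℂ) * Complex.I by push_cast; ring,
      Complex.norm_exp_ofReal_mul_I]
  rw [trigPoly, sum_band _ hp]
  refine (norm_add_le _ _).trans (add_le_add (le_of_eq ?_) (le_of_eq ?_))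
  · have : ∀ k ∈ Finset.Icc p M, phaseMul β a (k : ℤ) * Complex.exp (Complex.I * (k : ℤ) * x)
        = Complex.exp (-(Complex.I * ((β * Real.pi / 2 : ℝ) : ℂ))) *
          ((a k : ℂ) * Complex.exp (Complex.I * x) ^ k) := by
      intro k hk
      rw [Finset.mem_Icc] at hk
      rw [phaseMul, Int.sign_eq_one_of_pos (by omega), Int.natAbs_natCast, ← Complex.exp_nat_mul]
      push_cast
      ring_nf
    rw [Finset.sum_congr rfl this, ← Finset.mul_sum, norm_mul, hphase, one_mul]
  · have : ∀ k ∈ Finset.Icc q M, phaseMul β a (-(k : ℤ)) *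
          Complex.exp (Complex.I * (-(k : ℤ) : ℤ) * x)
        = Complex.exp (-(Complex.I * ((-(β * Real.pi / 2) : ℝ) : ℂ))) *
          (starRingEnd ℂ) ((a k : ℂ) * Complex.exp (Complex.I * x) ^ k) := by
      intro k hk
      rw [Finset.mem_Icc] at hk
      rw [phaseMul, Int.sign_eq_neg_one_of_neg (by omega), Int.natAbs_neg, Int.natAbs_natCast,
        map_mul, map_pow, ← Complex.exp_conj, ← Complex.exp_nat_mul, map_mul, Complex.conj_I,
        Complex.conj_ofReal, Complex.conj_ofReal]
      push_cast
      ring_nf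
    rw [Finset.sum_congr rfl this, ← Finset.mul_sum, norm_mul, hphase, one_mul, ← map_sum,
      Complex.norm_conj]

/-- `L_s` bound for a band-limited kernel with monotone symbol. -/
lemma eLpNorm_trigPoly_band_le {s : ℝ} (hs : 1 < s) (β : ℝ) {a : ℕ → ℝ} {n p q M : ℕ} {B lam : ℝ}
    (hn : 1 ≤ n) (hp : n ≤ p) (hq : n ≤ q) (hB0 : 0 ≤ B) (hl : 0 < lam)
    (h0 : ∀ k ∈ Icc n M, 0 ≤ a k) (hB : ∀ k ∈ Icc n M, a k ≤ B)
    (ha : MonotoneOn a (Icc n M) ∨ AntitoneOn a (Icc n M))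
    (hsum : ∑ k ∈ Finset.Icc n M, a k ≤ B * lam) :
    eLpNorm (trigPoly (phaseMul β a) (band p q M)) (ENNReal.ofReal s) periodMeasure
      ≤ ENNReal.ofReal ((2 * (1 + 1 / (s - 1))) ^ (1 / s) *
          (2 * Real.pi * B * lam ^ (1 - 1 / s))) := by
  have hpi := Real.pi_gt_three
  refine eLpNorm_le_of_peak hs hl (by positivity) (fun x => ?_) (fun x hx => ?_)
  · have one : ∀ r, n ≤ r →
        ‖∑ k ∈ Finset.Icc r M, (a k : ℂ) * Complex.exp (Complex.I * x) ^ k‖ ≤ B * lam := by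
      intro r hr
      refine (norm_sum_le _ _).trans (le_trans ?_ hsum)
      calc _ ≤ ∑ k ∈ Finset.Icc r M, a k := Finset.sum_le_sum fun k hk => by
            rw [Finset.mem_Icc] at hk
            have hz : ‖Complex.exp (Complex.I * x)‖ = 1 := by
              simp [mul_comm Complex.I, Complex.norm_exp_ofReal_mul_I]
            rw [norm_mul, norm_pow, hz, one_pow, mul_one, Complex.norm_real, Real.norm_eq_abs,
              abs_of_nonneg (h0 k ⟨hr.trans hk.1, hk.2⟩)]
        _ ≤ _ := Finset.sum_le_sum_of_subset_of_nonneg (Finset.Icc_subset_Icc_left hr)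
            fun k hk _ => h0 k (by simpa using hk)
    refine (norm_trigPoly_band_le β a (hn.trans hp) (hn.trans hq) M x).trans ?_
    have := one p hp
    have := one q hq
    nlinarith [mul_nonneg hB0 hl.le]
  · have one : ∀ r, n ≤ r → min x (2 * Real.pi - x) *
        ‖∑ k ∈ Finset.Icc r M, (a k : ℂ) * Complex.exp (Complex.I * x) ^ k‖ ≤ Real.pi * B := by
      intro r hr
      have hsub : Icc r M ⊆ Icc n M := Icc_subset_Icc_left hr
      exact min_mul_norm_sum_le hB0 (fun k hk => h0 k (hsub hk)) (fun k hk => hB k (hsub hk))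
        (ha.imp (fun h => h.mono hsub) (fun h => h.mono hsub)) hx
    have hmin : 0 ≤ min x (2 * Real.pi - x) := le_min hx.1.le (by linarith [hx.2])
    have := mul_le_mul_of_nonneg_left
      (norm_trigPoly_band_le β a (hn.trans hp) (hn.trans hq) M x) hmin
    have := one p hp
    have := one q hq
    linarith

/-! ### The upper bound -/

lemma norm_coeff_le_one {φ : ℝ → ℝ} (hφ : IsPeriodicLp 1 φ) (hφ1 : eLpNorm φ 1 periodMeasure ≤ 1)
    (k : ℤ) : ‖coeff φ k‖ ≤ 1 := by
  have hφi := memLp_one_iff_integrable.1 hφ.2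
  have h1 : ∫ t, ‖φ t‖ ∂periodMeasure ≤ 1 := by
    rw [integral_norm_eq_lintegral_enorm hφi.1]
    rw [eLpNorm_one_eq_lintegral_enorm] at hφ1
    exact ENNReal.toReal_le_of_le_ofReal zero_le_one (by simpa using hφ1)
  rw [coeff_eq_integral hφ.1, norm_mul]
  have h2 : ‖(2 * Real.pi : ℂ)⁻¹‖ ≤ 1 := by
    rw [norm_inv, norm_mul, Complex.norm_ofNat, Complex.norm_real, Real.norm_eq_abs,
      abs_of_pos Real.pi_pos]
    exact inv_le_one_of_one_le₀ (by linarith [Real.pi_gt_three])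
  have h3 : ‖∫ t, Complex.exp (Complex.I * (-k : ℤ) * t) * (φ t : ℂ) ∂periodMeasure‖ ≤ 1 := by
    refine (norm_integral_le_integral_norm _).trans (le_trans (le_of_eq ?_) h1)
    refine integral_congr_ae (Eventually.of_forall fun t => ?_)
    simp only [norm_mul, norm_exp_I_mul, one_mul, Complex.norm_real]
  calc _ ≤ (1 : ℝ) * 1 := mul_le_mul h2 h3 (norm_nonneg _) zero_le_one
    _ = 1 := one_mul 1

lemma coeff_eq_mul_phaseMul {ψ : ℝ → ℝ} (hψ : ψ ∈ classM) {β : ℝ} {f φ : ℝ → ℝ}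
    (h : IsPsiBetaDeriv ψ β f φ) {k : ℤ} (hk : k ≠ 0) :
    coeff f k = coeff φ k * phaseMul β (fun j => ψ j) k := by
  have hpos : ψ ((|k| : ℤ) : ℝ) ≠ 0 :=
    (hψ.1 _ (by exact_mod_cast Int.one_le_abs hk)).ne'
  have hc : (ψ ((|k| : ℤ) : ℝ) : ℂ) ≠ 0 := by exact_mod_cast hpos
  rw [h.2.2 k hk, phaseMul, Nat.cast_natAbs, Complex.exp_neg]
  have := Complex.exp_ne_zero (Complex.I * ((β * Real.pi / 2 * (k.sign : ℝ) : ℝ) : ℂ))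
  field_simp

lemma norm_phaseMul (β : ℝ) (a : ℕ → ℝ) (k : ℤ) : ‖phaseMul β a k‖ = |a k.natAbs| := by
  rw [phaseMul, norm_mul, Complex.norm_real, Real.norm_eq_abs]
  have : ∀ r : ℝ, ‖Complex.exp (-(Complex.I * (r : ℂ)))‖ = 1 := by
    intro r
    rw [show -(Complex.I * (r : ℂ)) = ((-r : ℝ) : ℂ) * Complex.I by push_cast; ring,
      Complex.norm_exp_ofReal_mul_I]
  rw [this, mul_one]

/-- The coefficients of φ have modulus at most 1, so those of f are dominated by ψ(|k|), summable by
the tail estimate at n = 1. -/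
lemma summable_coeff {ψ : ℝ → ℝ} (hψ : ψ ∈ classMTwo) {β : ℝ} {f φ : ℝ → ℝ}
    (h : IsPsiBetaDeriv ψ β f φ) (hφ1 : eLpNorm φ 1 periodMeasure ≤ 1) :
    Summable fun k => ‖coeff f k‖ := by
  obtain ⟨C, -, hC⟩ := exists_sum_Ico_le hψ
  have hpos : ∀ i : ℕ, 0 ≤ ψ ((i + 1 : ℕ) : ℝ) := fun i =>
    (hψ.1.1.1 _ (by exact_mod_cast Nat.le_add_left 1 i)).le
  have hsum : Summable fun i : ℕ => ψ ((i + 1 : ℕ) : ℝ) := by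
    refine summable_of_sum_range_le (c := C * (ψ (1 : ℕ) * (eta ψ (1 : ℕ) - (1 : ℕ)))) hpos fun N => ?_
    have := hC 1 le_rfl (N + 1)
    rw [Finset.sum_Ico_eq_sum_range, Nat.add_sub_cancel] at this
    simpa only [add_comm 1] using this
  have hle : ∀ k : ℤ, k ≠ 0 → ‖coeff f k‖ ≤ |ψ (k.natAbs : ℝ)| := by
    intro k hk
    rw [coeff_eq_mul_phaseMul hψ.1.1 h hk, norm_mul, norm_phaseMul]
    exact mul_le_of_le_one_left (abs_nonneg _) (norm_coeff_le_one h.1 hφ1 k)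
  refine Summable.of_nat_of_neg ?_ ?_
  · refine (summable_nat_add_iff 1).1 (hsum.of_nonneg_of_le (fun _ => norm_nonneg _) fun i => ?_)
    refine (hle _ (by omega)).trans (le_of_eq ?_)
    rw [Int.natAbs_natCast, abs_of_nonneg (hpos i)]
  · refine (summable_nat_add_iff 1).1 (hsum.of_nonneg_of_le (fun _ => norm_nonneg _) fun i => ?_)
    refine (hle _ (by omega)).trans (le_of_eq ?_)
    rw [Int.natAbs_neg, Int.natAbs_natCast, abs_of_nonneg (hpos i)]

lemma tendsto_trigPoly_band {c : ℤ → ℂ} {x : ℝ} {y : ℂ}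
    (h : HasSum (fun k : ℤ => c k * Complex.exp (Complex.I * k * x)) y) {p q : ℕ}
    (hp : 1 ≤ p) (hq : 1 ≤ q) :
    Tendsto (fun M : ℕ => trigPoly c (band p q M) x) atTop
      (𝓝 (y - trigPoly c (Finset.Ioo (-q : ℤ) p) x)) := by
  have hIcc : Tendsto (fun M : ℕ => Finset.Icc (-M : ℤ) M) atTop atTop := by
    refine tendsto_atTop_finset_of_monotone (fun a b hab => ?_) fun k => ⟨k.natAbs, ?_⟩
    · exact Finset.Icc_subset_Icc (by omega) (by omega)
    · rw [Finset.mem_Icc]; omega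
  have h1 : Tendsto (fun M : ℕ => trigPoly c (Finset.Icc (-M : ℤ) M) x) atTop (𝓝 y) :=
    Tendsto.comp (f := fun M : ℕ => Finset.Icc (-M : ℤ) M)
      (g := fun S : Finset ℤ => trigPoly c S x) (by simpa [HasSum, trigPoly] using h) hIcc
  refine (h1.sub_const _).congr' ?_
  filter_upwards [eventually_ge_atTop (max p q)] with M hM
  have hMp : p ≤ M := (le_max_left _ _).trans hM
  have hMq : q ≤ M := (le_max_right _ _).trans hM
  have hd : Disjoint (band p q M) (Finset.Ioo (-q : ℤ) p) := by
    rw [Finset.disjoint_left]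
    intro k hk hk'
    simp only [band, Finset.mem_union, Finset.mem_Icc, Finset.mem_Ioo] at hk hk'
    omega
  have hu : Finset.Icc (-M : ℤ) M = band p q M ∪ Finset.Ioo (-q : ℤ) p := by
    ext k
    simp only [band, Finset.mem_union, Finset.mem_Icc, Finset.mem_Ioo]
    omega
  rw [hu, trigPoly, Finset.sum_union hd, trigPoly, trigPoly, add_sub_cancel_right]

/-- The upper bound: the error of the Fourier sum with frequencies in `(-q, p)`. -/
lemma exists_eLpNorm_sub_partialSum_le {ψ : ℝ → ℝ} (hψ : ψ ∈ classMTwo) {s : ℝ} (hs : 1 < s)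
    (β : ℝ) : ∃ C : ℝ, 0 < C ∧ ∀ n : ℕ, 1 ≤ n → ∀ p q : ℕ, n ≤ p → n ≤ q → ∀ f ∈ psiClass ψ β 1,
      eLpNorm (fun x => (f x : ℂ) - partialSum (Finset.Ioo (-q : ℤ) p) f x) (ENNReal.ofReal s)
        periodMeasure ≤ ENNReal.ofReal (C * (ψ n * (eta ψ n - n) ^ (1 - 1 / s))) := by
  obtain ⟨C, hC0, hC⟩ := exists_sum_Ico_le hψ
  have hs1 : 0 < s - 1 := by linarith
  have hpi := Real.pi_pos
  refine ⟨(2 * (1 + 1 / (s - 1))) ^ (1 / s) * (2 * Real.pi * C ^ (1 - 1 / s)), by positivity, ?_⟩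
  rintro n hn p q hp hq f ⟨hf, φ, hφ, hφp, hφ1, -⟩
  have hn1 : (1 : ℝ) ≤ n := by exact_mod_cast hn
  have hL : 0 < eta ψ n - n := by
    obtain ⟨-, K, hK0, hK⟩ := hψ
    exact hK0.trans_le (hK n hn1)
  have hψn := hψ.1.1.1 n hn1
  have hanti := antitoneOn_of_mem_classM hψ.1.1
  have hge : ∀ {k : ℕ}, n ≤ k → (1 : ℝ) ≤ k := fun h => by exact_mod_cast hn.trans h
  -- Fatou: the remainder is the a.e. limit of its truncations to |k| ≤ M, and these are bounded
  -- uniformly in M.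
  refine (Lp.eLpNorm_lim_le_liminf_eLpNorm (f := fun M => trigPoly (coeff f) (band p q M))
    (fun M => (continuous_trigPoly _ _).aestronglyMeasurable) _ ?_).trans ?_
  · filter_upwards [ae_hasSum_coeff hf (summable_coeff hψ hφ hφ1)] with x hx
    exact tendsto_trigPoly_band hx (hn.trans hp) (hn.trans hq)
  · refine liminf_le_of_le (by isBoundedDefault) fun b hb => ?_
    obtain ⟨M, hM⟩ := hb.exists
    refine hM.trans ?_
    have e1 : trigPoly (coeff f) (band p q M)
        = trigPoly (fun k => coeff φ k * phaseMul β (fun j => ψ j) k) (band p q M) := by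
      funext x
      refine Finset.sum_congr rfl fun k hk => ?_
      simp only [band, Finset.mem_union, Finset.mem_Icc] at hk
      rw [coeff_eq_mul_phaseMul hψ.1.1 hφ (by omega)]
    rw [e1]
    refine (eLpNorm_multiplier_le hφp hφ1 hs _ _).trans ?_
    refine (eLpNorm_trigPoly_band_le hs β (B := ψ n) (lam := C * (eta ψ n - n)) hn hp hq hψn.le
      (by positivity) (fun k hk => (hψ.1.1.1 k (hge hk.1)).le)
      (fun k hk => hanti hn1 (hge hk.1) (by exact_mod_cast hk.1))
      (Or.inr fun i hi j hj hij => hanti (hge hi.1) (hge hj.1) (by exact_mod_cast hij)) ?_).trans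
      (le_of_eq ?_)
    · refine le_trans (le_of_eq ?_) ((hC n hn (M + 1)).trans (le_of_eq (by ring)))
      rfl
    · congr 1
      rw [Real.mul_rpow hC0.le hL.le]
      ring

/-! ### Coefficients of real trigonometric polynomials -/

lemma integral_exp_neg_mul_trigPoly (c : ℤ → ℂ) (S : Finset ℤ) (k : ℤ) :
    ∫ t, Complex.exp (Complex.I * (-k : ℤ) * t) * trigPoly c S t ∂periodMeasure
      = 2 * Real.pi * if k ∈ S then c k else 0 := by
  have h1 : ∀ t : ℝ, Complex.exp (Complex.I * (-k : ℤ) * t) * trigPoly c S t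
      = ∑ j ∈ S, c j * Complex.exp (Complex.I * (j - k : ℤ) * t) := by
    intro t
    rw [trigPoly, Finset.mul_sum]
    refine Finset.sum_congr rfl fun j _ => ?_
    rw [mul_left_comm, ← Complex.exp_add]
    push_cast
    ring_nf
  simp only [h1]
  rw [integral_finsetSum _ fun j _ =>
    (integrable_of_continuous (continuous_exp_I_mul (j - k))).const_mul _]
  simp only [integral_const_mul, integral_exp_I_mul, sub_eq_zero, mul_ite, mul_zero]
  rw [Finset.sum_ite_eq' S k]
  split_ifs <;> ring

section RealTrigPoly

variable {c : ℤ → ℂ}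

lemma ofReal_re_trigPoly (hc : ∀ k, c (-k) = (starRingEnd ℂ) (c k)) (R : ℕ) (x : ℝ) :
    (((trigPoly c (Finset.Icc (-R : ℤ) R) x).re : ℝ) : ℂ) = trigPoly c (Finset.Icc (-R : ℤ) R) x := by
  rw [← Complex.conj_eq_iff_re, trigPoly, map_sum]
  refine Finset.sum_nbij' (fun k => -k) (fun k => -k) ?_ ?_ ?_ ?_ ?_ <;> intro k hk
  · simp only [Finset.mem_Icc] at hk ⊢; omega
  · simp only [Finset.mem_Icc] at hk ⊢; omega
  · exact neg_neg k
  · exact neg_neg k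
  · rw [hc, map_mul, ← Complex.exp_conj, map_mul, map_mul, Complex.conj_I, Complex.conj_ofReal]
    simp

lemma isPeriodicLp_re_trigPoly (c : ℤ → ℂ) (S : Finset ℤ) :
    IsPeriodicLp 1 (fun x => (trigPoly c S x).re) := by
  refine ⟨fun x => by simp only [periodic_trigPoly c S x], ?_⟩
  exact memLp_one_iff_integrable.2 (integrable_of_continuous (continuous_trigPoly c S)).re

lemma coeff_re_trigPoly (hc : ∀ k, c (-k) = (starRingEnd ℂ) (c k)) (R : ℕ) (k : ℤ) :
    coeff (fun x => (trigPoly c (Finset.Icc (-R : ℤ) R) x).re) k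
      = if k ∈ Finset.Icc (-R : ℤ) R then c k else 0 := by
  rw [coeff_eq_integral (isPeriodicLp_re_trigPoly c _).1]
  simp only [ofReal_re_trigPoly hc]
  rw [integral_exp_neg_mul_trigPoly, ← mul_assoc, inv_mul_cancel₀, one_mul]
  exact_mod_cast Real.two_pi_pos.ne'

end RealTrigPoly

/-! ### The Fejér kernel and the extremal function -/

/-- The number of pairs `(j, l)` with `0 ≤ j, l < R` and `j - l = k`. -/
def fejerCount (R : ℕ) (k : ℤ) : ℕ :=
  ((Finset.range R ×ˢ Finset.range R).filter fun x => (x.1 : ℤ) - x.2 = k).card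

lemma fejerCount_neg (R : ℕ) (k : ℤ) : fejerCount R (-k) = fejerCount R k := by
  refine Finset.card_nbij' Prod.swap Prod.swap ?_ ?_ ?_ ?_ <;> rintro ⟨j, l⟩ h <;>
    simp only [Finset.coe_filter, Finset.mem_product, Finset.mem_range, mem_ofPred_eq, Prod.swap] at h ⊢
      <;> omega

lemma fejerCount_zero (R : ℕ) : fejerCount R 0 = R := by
  conv_rhs => rw [← Finset.card_range R]
  refine Finset.card_nbij' Prod.fst (fun j => (j, j)) ?_ ?_ ?_ ?_
  · rintro ⟨j, l⟩ h
    simp only [Finset.coe_filter, Finset.mem_product, Finset.mem_range, mem_ofPred_eq,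
      Finset.coe_range, mem_Iio] at h ⊢
    omega
  · intro j h
    simp only [Finset.coe_filter, Finset.mem_product, Finset.mem_range, mem_ofPred_eq,
      Finset.coe_range, mem_Iio] at h ⊢
    omega
  · rintro ⟨j, l⟩ h
    simp only [Finset.coe_filter, Finset.mem_product, Finset.mem_range, mem_ofPred_eq] at h
    rw [Prod.mk.injEq]
    omega
  · intro j _; rfl

lemma fejerCount_eq_zero {R : ℕ} {k : ℤ} (hk : k ∉ Finset.Icc (-R : ℤ) R) : fejerCount R k = 0 := by
  rw [fejerCount, Finset.card_eq_zero, Finset.filter_eq_empty_iff]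
  rintro ⟨j, l⟩ h
  simp only [Finset.mem_product, Finset.mem_range, Finset.mem_Icc] at h hk ⊢
  omega

/-- For 0 ≤ k ≤ N the pairs (l + k, l) with l < N all count; negative k follows by symmetry. -/
lemma le_fejerCount {N : ℕ} {k : ℤ} (hk : k.natAbs ≤ N) : N ≤ fejerCount (2 * N) k := by
  have key : ∀ k : ℕ, k ≤ N → N ≤ fejerCount (2 * N) k := by
    intro k hk
    conv_lhs => rw [← Finset.card_range N]
    refine Finset.card_le_card_of_injOn (fun l => (l + k, l)) ?_ ?_
    · intro l h
      simp only [Finset.coe_filter, Finset.mem_product, Finset.mem_range, mem_ofPred_eq,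
        Finset.coe_range, mem_Iio] at h ⊢
      push_cast
      omega
    · intro a _ b _ h
      exact (Prod.mk.injEq .. ▸ h).2
  rcases Int.natAbs_eq k with h | h
  · rw [h]; exact key _ hk
  · rw [h, fejerCount_neg]; exact key _ hk

/-- Expanding the squared modulus of the sum of R exponentials and grouping by frequency difference
exhibits the kernel as nonnegative. -/
lemma trigPoly_fejerCount (R : ℕ) (x : ℝ) :
    trigPoly (fun k => (fejerCount R k : ℂ)) (Finset.Icc (-R : ℤ) R) x
      = ((‖∑ j ∈ Finset.range R, Complex.exp (Complex.I * (j : ℤ) * x)‖ ^ 2 : ℝ) : ℂ) := by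
  have h1 : ((‖∑ j ∈ Finset.range R, Complex.exp (Complex.I * (j : ℤ) * x)‖ ^ 2 : ℝ) : ℂ)
      = ∑ z ∈ Finset.range R ×ˢ Finset.range R,
          Complex.exp (Complex.I * ((z.1 : ℤ) - z.2 : ℤ) * x) := by
    push_cast
    rw [← Complex.mul_conj', map_sum, Finset.sum_mul_sum, Finset.sum_product]
    refine Finset.sum_congr rfl fun j _ => Finset.sum_congr rfl fun l _ => ?_
    rw [← Complex.exp_conj, map_mul, map_mul, Complex.conj_I, Complex.conj_ofReal, map_natCast,
      ← Complex.exp_add]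
    ring_nf
  rw [h1, ← Finset.sum_fiberwise_of_maps_to (t := Finset.Icc (-R : ℤ) R)
    (g := fun z : ℕ × ℕ => (z.1 : ℤ) - z.2)]
  · refine Finset.sum_congr rfl fun k _ => ?_
    rw [Finset.sum_congr rfl (g := fun _ => Complex.exp (Complex.I * k * x)) fun z hz => by
      rw [(Finset.mem_filter.1 hz).2], Finset.sum_const, nsmul_eq_mul]
    rfl
  · rintro ⟨j, l⟩ h
    simp only [Finset.mem_product, Finset.mem_range, Finset.mem_Icc] at h ⊢
    omega

/-- Fourier coefficients of a normalised Fejér kernel without its constant term. -/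
noncomputable def fejerCoeff (R : ℕ) (k : ℤ) : ℝ :=
  if k = 0 then 0 else fejerCount R k / (4 * Real.pi * R)

lemma fejerCoeff_neg (R : ℕ) (k : ℤ) : fejerCoeff R (-k) = fejerCoeff R k := by
  simp only [fejerCoeff, neg_eq_zero, fejerCount_neg]

lemma le_fejerCoeff {N : ℕ} (hN : 1 ≤ N) {k : ℤ} (hk0 : k ≠ 0) (hk : k.natAbs ≤ N) :
    1 / (8 * Real.pi) ≤ fejerCoeff (2 * N) k := by
  have hpi := Real.pi_pos
  have hN0 : (0 : ℝ) < N := by exact_mod_cast hN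
  have h : (N : ℝ) ≤ fejerCount (2 * N) k := by exact_mod_cast le_fejerCount hk
  rw [fejerCoeff, if_neg hk0, div_le_div_iff₀ (by positivity) (by positivity)]
  push_cast
  nlinarith [mul_le_mul_of_nonneg_left h hpi.le]

/-- The normalised Fejér kernel of degree `R` without its constant term. -/
noncomputable def fejer (R : ℕ) (x : ℝ) : ℝ :=
  (trigPoly (fun k => (fejerCoeff R k : ℂ)) (Finset.Icc (-R : ℤ) R) x).re

lemma coeff_fejer (R : ℕ) (k : ℤ) : coeff (fejer R) k = fejerCoeff R k := by
  have := coeff_re_trigPoly (c := fun k => (fejerCoeff R k : ℂ))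
    (fun k => by rw [fejerCoeff_neg, Complex.conj_ofReal]) R k
  refine this.trans ?_
  split_ifs with h
  · rfl
  · simp [fejerCoeff, fejerCount_eq_zero h]

lemma integral_fejer (R : ℕ) : ∫ t, fejer R t ∂periodMeasure = 0 := by
  have h := coeff_eq_integral (isPeriodicLp_re_trigPoly (fun k => (fejerCoeff R k : ℂ))
    (Finset.Icc (-R : ℤ) R)).1 0
  have h0 := coeff_fejer R 0
  rw [fejerCoeff, if_pos rfl] at h0
  change coeff (fejer R) 0 = _ at h
  rw [h0] at h
  have hpi : (2 * Real.pi : ℂ)⁻¹ ≠ 0 := inv_ne_zero (by exact_mod_cast Real.two_pi_pos.ne')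
  have h' := (mul_eq_zero.1 h.symm).resolve_left hpi
  simp only [neg_zero, Int.cast_zero, mul_zero, zero_mul, Complex.exp_zero, one_mul] at h'
  rw [integral_complex_ofReal] at h'
  exact_mod_cast h'

lemma fejer_ge {R : ℕ} (hR : 1 ≤ R) (x : ℝ) : 0 ≤ fejer R x + 1 / (4 * Real.pi) := by
  have hpi := Real.pi_pos
  have hR0 : (0 : ℝ) < R := by exact_mod_cast hR
  have h1 : trigPoly (fun k => (fejerCoeff R k : ℂ)) (Finset.Icc (-R : ℤ) R) x
        + ((1 / (4 * Real.pi) : ℝ) : ℂ)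
      = ((1 / (4 * Real.pi * R) : ℝ) : ℂ) *
        trigPoly (fun k => (fejerCount R k : ℂ)) (Finset.Icc (-R : ℤ) R) x := by
    have h0 : (0 : ℤ) ∈ Finset.Icc (-R : ℤ) R := by rw [Finset.mem_Icc]; omega
    rw [trigPoly, trigPoly, Finset.mul_sum, ← Finset.add_sum_erase _ _ h0,
      ← Finset.add_sum_erase (Finset.Icc (-R : ℤ) R) (fun k => ((1 / (4 * Real.pi * R) : ℝ) : ℂ) *
        ((fejerCount R k : ℂ) * Complex.exp (Complex.I * k * x))) h0, fejerCoeff, if_pos rfl,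
      fejerCount_zero]
    have : ∀ k ∈ (Finset.Icc (-R : ℤ) R).erase 0,
        (fejerCoeff R k : ℂ) * Complex.exp (Complex.I * k * x) = ((1 / (4 * Real.pi * R) : ℝ) : ℂ) *
        ((fejerCount R k : ℂ) * Complex.exp (Complex.I * k * x)) := by
      intro k hk
      rw [fejerCoeff, if_neg (Finset.ne_of_mem_erase hk)]
      push_cast
      ring
    rw [Finset.sum_congr rfl this]
    have hpi' : (Real.pi : ℂ) ≠ 0 := by exact_mod_cast hpi.ne'
    have hR' : (R : ℂ) ≠ 0 := by exact_mod_cast hR0.ne'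
    simp only [Int.cast_zero, mul_zero, zero_mul, Complex.exp_zero, mul_one, Complex.ofReal_zero,
      zero_add]
    rw [add_comm]
    congr 1
    push_cast
    field_simp
  rw [trigPoly_fejerCount, ← Complex.ofReal_mul] at h1
  have h2 := congrArg Complex.re h1
  rw [Complex.add_re, Complex.ofReal_re, Complex.ofReal_re] at h2
  change fejer R x + _ = _ at h2
  rw [h2]
  positivity

/-- The full kernel is nonnegative with mean 1/(4π), so it has L_1 norm 1/2; the removed constant
costs another 1/2. This explains the factor 4π in the normalisation. -/
lemma fejer_mem_unitBallZero {R : ℕ} (hR : 1 ≤ R) : fejer R ∈ unitBallZero 1 := by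
  have hpi := Real.pi_pos
  have hp : IsPeriodicLp 1 (fejer R) := isPeriodicLp_re_trigPoly _ _
  have hi := memLp_one_iff_integrable.1 hp.2
  refine ⟨hp, ?_, integral_fejer R⟩
  rw [eLpNorm_one_eq_lintegral_enorm, ← ofReal_integral_norm_eq_lintegral_enorm hi,
    ENNReal.ofReal_le_one]
  have hc : Integrable (fun _ : ℝ => 1 / (2 * Real.pi)) periodMeasure := integrable_const _
  calc ∫ x, ‖fejer R x‖ ∂periodMeasure
      ≤ ∫ x, (fejer R x + 1 / (2 * Real.pi)) ∂periodMeasure := by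
        refine integral_mono hi.norm (hi.add hc) fun x => ?_
        have := fejer_ge hR x
        have e : 1 / (2 * Real.pi) = 1 / (4 * Real.pi) + 1 / (4 * Real.pi) := by field_simp; norm_num
        have h0 : 0 < 1 / (4 * Real.pi) := by positivity
        simp only [Real.norm_eq_abs]
        rw [abs_le]
        constructor <;> linarith
    _ = 1 := by
        rw [integral_add hi hc, integral_fejer, integral_periodMeasure]
        simp only [intervalIntegral.integral_const, smul_eq_mul]
        field_simp
        ring

lemma phaseMul_neg (β : ℝ) (a : ℕ → ℝ) (k : ℤ) :
    phaseMul β a (-k) = (starRingEnd ℂ) (phaseMul β a k) := by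
  rw [phaseMul, phaseMul, Int.natAbs_neg, Int.sign_neg, map_mul, Complex.conj_ofReal,
    ← Complex.exp_conj, map_neg, map_mul, Complex.conj_I, Complex.conj_ofReal]
  push_cast
  ring_nf

/-- The `(ψ, β)`-integral of the Fejér kernel. -/
noncomputable def extremal (ψ : ℝ → ℝ) (β : ℝ) (R : ℕ) (x : ℝ) : ℝ :=
  (trigPoly (fun k => (fejerCoeff R k : ℂ) * phaseMul β (fun j => ψ j) k)
    (Finset.Icc (-R : ℤ) R) x).re

lemma coeff_extremal (ψ : ℝ → ℝ) (β : ℝ) (R : ℕ) (k : ℤ) :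
    coeff (extremal ψ β R) k = (fejerCoeff R k : ℂ) * phaseMul β (fun j => ψ j) k := by
  have := coeff_re_trigPoly (c := fun k => (fejerCoeff R k : ℂ) * phaseMul β (fun j => ψ j) k)
    (fun k => by rw [fejerCoeff_neg, phaseMul_neg, map_mul, Complex.conj_ofReal]) R k
  refine this.trans ?_
  split_ifs with h
  · rfl
  · simp [fejerCoeff, fejerCount_eq_zero h]

lemma extremal_mem_psiClass {ψ : ℝ → ℝ} (hψ : ψ ∈ classM) (β : ℝ) {R : ℕ} (hR : 1 ≤ R) :
    extremal ψ β R ∈ psiClass ψ β 1 := by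
  have hφ := fejer_mem_unitBallZero hR
  refine ⟨isPeriodicLp_re_trigPoly _ _, fejer R, ⟨hφ.1, ?_, fun k hk => ?_⟩, hφ⟩
  · rw [coeff_fejer, fejerCoeff, if_pos rfl, Complex.ofReal_zero]
  · rw [coeff_fejer, coeff_extremal, phaseMul, Nat.cast_natAbs, Complex.exp_neg]
    have hc : (ψ ((|k| : ℤ) : ℝ) : ℂ) ≠ 0 := by
      exact_mod_cast (hψ.1 _ (by exact_mod_cast Int.one_le_abs hk)).ne'
    have := Complex.exp_ne_zero (Complex.I * ((β * Real.pi / 2 * (k.sign : ℝ) : ℝ) : ℂ))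
    field_simp

/-! ### The lower bound by duality -/

lemma phaseMul_mul_conj (β : ℝ) (a b : ℕ → ℝ) (k : ℤ) :
    phaseMul β a k * (starRingEnd ℂ) (phaseMul β b k) = ((a k.natAbs * b k.natAbs : ℝ) : ℂ) := by
  rw [phaseMul, phaseMul, map_mul, ← Complex.exp_conj, mul_mul_mul_comm, ← Complex.exp_add, map_neg,
    map_mul, Complex.conj_I, Complex.conj_ofReal, Complex.conj_ofReal]
  simp

lemma card_band_one (N : ℕ) : (band 1 1 N).card = 2 * N := by
  rw [band, Finset.card_union_of_disjoint (disjoint_band le_rfl N), Int.card_Icc, Int.card_Icc]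
  omega

/-- Parseval against a polynomial: subtracting S_γ(f) simply deletes the frequencies of γ from the
pairing. -/
lemma integral_sub_partialSum_mul_conj {f : ℝ → ℝ} (hf : IsPeriodicLp 1 f) (γ : Finset ℤ)
    (b : ℤ → ℂ) (S : Finset ℤ) :
    ∫ t, ((f t : ℂ) - partialSum γ f t) * (starRingEnd ℂ) (trigPoly b S t) ∂periodMeasure
      = 2 * Real.pi * ∑ k ∈ S \ γ, coeff f k * (starRingEnd ℂ) (b k) := by
  have hfi : Integrable (fun t => (f t : ℂ)) periodMeasure :=
    (memLp_one_iff_integrable.1 hf.2).ofReal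
  have hpi : Integrable (fun t => partialSum γ f t) periodMeasure :=
    integrable_of_continuous (continuous_trigPoly (coeff f) γ)
  have h1 : ∀ t : ℝ, ((f t : ℂ) - partialSum γ f t) * (starRingEnd ℂ) (trigPoly b S t)
      = ∑ k ∈ S, (starRingEnd ℂ) (b k) *
        (Complex.exp (Complex.I * (-k : ℤ) * t) * ((f t : ℂ) - partialSum γ f t)) := by
    intro t
    rw [trigPoly, map_sum, Finset.mul_sum]
    refine Finset.sum_congr rfl fun k _ => ?_
    rw [map_mul, ← Complex.exp_conj, map_mul, map_mul, Complex.conj_I, Complex.conj_ofReal]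
    have : (starRingEnd ℂ) (k : ℂ) = k := map_intCast _ k
    rw [this]
    push_cast
    ring_nf
  simp only [h1]
  have hsub : Integrable (fun t => (f t : ℂ) - partialSum γ f t) periodMeasure := hfi.sub hpi
  rw [integral_finsetSum _ fun k _ => (integrable_exp_mul hsub (-k)).const_mul _]
  have h2 : ∀ k : ℤ, ∫ t, Complex.exp (Complex.I * (-k : ℤ) * t) *
      ((f t : ℂ) - partialSum γ f t) ∂periodMeasure
      = 2 * Real.pi * if k ∈ γ then 0 else coeff f k := by
    intro k
    simp only [mul_sub]
    rw [integral_sub (integrable_exp_mul hfi (-k)) (integrable_exp_mul hpi (-k))]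
    have e1 := coeff_eq_integral hf.1 k
    have e2 := integral_exp_neg_mul_trigPoly (coeff f) γ k
    have hpi' : (2 * Real.pi : ℂ) ≠ 0 := by exact_mod_cast Real.two_pi_pos.ne'
    change ∫ t, Complex.exp (Complex.I * (-k : ℤ) * t) * partialSum γ f t ∂periodMeasure = _ at e2
    rw [e2, ← mul_inv_cancel_left₀ hpi' (∫ t, _ ∂periodMeasure), ← e1]
    split_ifs <;> ring
  simp only [integral_const_mul, h2]
  rw [Finset.mul_sum, Finset.sdiff_eq_filter, Finset.sum_filter]
  refine Finset.sum_congr rfl fun k _ => ?_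
  split_ifs with h <;> ring

/-- The lower bound: one function of the class is badly approximated for all `γ`. -/
lemma exists_le_eLpNorm_sub_partialSum {ψ : ℝ → ℝ} (hψ : ψ ∈ classMTwo)
    (hratio : IncreasesToInfinity (decayRatio ψ)) {s s' : ℝ} (hss : s.HolderConjugate s') (β : ℝ) :
    ∃ c : ℝ, 0 < c ∧ ∀ n : ℕ, 1 ≤ n → ∃ f ∈ psiClass ψ β 1, ∀ γ : Finset ℤ, γ.card ≤ 2 * n →
      ENNReal.ofReal (c * (ψ n * (eta ψ n - n) ^ (1 / s'))) ≤
        eLpNorm (fun x => (f x : ℂ) - partialSum γ f x) (ENNReal.ofReal s) periodMeasure := by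
  obtain ⟨C, hC0, hC⟩ := exists_sum_inv_le hψ hratio
  have hs' : 1 < s' := hss.symm.lt
  have hs1 : 0 < s' - 1 := by linarith
  have hpi := Real.pi_pos
  set G : ℝ := (2 * (1 + 1 / (s' - 1))) ^ (1 / s') * (2 * Real.pi * C) with hG
  have hG0 : 0 < G := by positivity
  refine ⟨1 / (2 * G), by positivity, fun n hn => ?_⟩
  have hn1 : (1 : ℝ) ≤ n := by exact_mod_cast hn
  have hL : 0 < eta ψ n - n := by
    obtain ⟨-, K, hK0, hK⟩ := hψ
    exact hK0.trans_le (hK n hn1)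
  have hM := hψ.1.1
  have hψn := hM.1 n hn1
  have hanti := antitoneOn_of_mem_classM hM
  obtain ⟨hCn1, hCn2⟩ := hC n hn
  set L := eta ψ n - n with hLdef
  set N := n + ⌈L⌉₊ with hN
  have hN1 : 1 ≤ N := by omega
  have hge : ∀ {k : ℕ}, 1 ≤ k → (1 : ℝ) ≤ k := fun h => by exact_mod_cast h
  refine ⟨extremal ψ β (2 * N), extremal_mem_psiClass hM β (by omega), fun γ hγ => ?_⟩
  set f := extremal ψ β (2 * N) with hf
  have hfp : IsPeriodicLp 1 f := isPeriodicLp_re_trigPoly _ _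
  -- The test polynomial inverts the multiplier ψ and repeats its phase, so paired with f it sees
  -- only ψ(n) times the Fejér coefficients.
  set b := phaseMul β (fun k => ψ n / ψ k) with hb
  set g := trigPoly b (band 1 1 N) with hg
  have hgnorm : eLpNorm g (ENNReal.ofReal s') periodMeasure
      ≤ ENNReal.ofReal (G * L ^ (1 - 1 / s')) := by
    refine (eLpNorm_trigPoly_band_le hs' β (n := 1) (B := C) (lam := L) le_rfl le_rfl le_rfl hC0.le hL
      (fun k hk => (div_pos hψn (hM.1 k (hge hk.1))).le) (fun k hk => ?_)
      (Or.inl fun i hi j hj hij => ?_) hCn2).trans (le_of_eq ?_)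
    · rw [div_le_iff₀ (hM.1 k (hge hk.1))]
      exact hCn1.trans (mul_le_mul_of_nonneg_left
        (hanti (hge hk.1) (hge hN1) (by exact_mod_cast hk.2)) hC0.le)
    · exact div_le_div_of_nonneg_left hψn.le (hM.1 j (hge hj.1))
        (hanti (hge hi.1) (hge hj.1) (by exact_mod_cast hij))
    · congr 1; rw [hG]; ring
  have hpair : ENNReal.ofReal (ψ n * L / 2) ≤
      ‖∫ t, ((f t : ℂ) - partialSum γ f t) * (starRingEnd ℂ) (g t) ∂periodMeasure‖ₑ := by
    rw [hg, integral_sub_partialSum_mul_conj hfp, ← ofReal_norm]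
    refine ENNReal.ofReal_le_ofReal ?_
    have hterm : ∀ k ∈ band 1 1 N \ γ, coeff f k * (starRingEnd ℂ) (b k)
        = ((fejerCoeff (2 * N) k * ψ n : ℝ) : ℂ) := by
      intro k hk
      have hk1 : 1 ≤ k.natAbs := by
        simp only [band, Finset.mem_sdiff, Finset.mem_union, Finset.mem_Icc] at hk
        omega
      rw [hf, coeff_extremal, hb, mul_assoc, phaseMul_mul_conj, ← Complex.ofReal_mul]
      have := (hM.1 k.natAbs (hge hk1)).ne'
      congr 2
      field_simp
    rw [Finset.sum_congr rfl hterm, ← Complex.ofReal_sum, norm_mul, norm_mul, Complex.norm_ofNat,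
      Complex.norm_real, Complex.norm_real, Real.norm_of_nonneg hpi.le]
    refine le_trans ?_ (mul_le_mul_of_nonneg_left (le_abs_self _) (by positivity))
    have hsum : ((band 1 1 N \ γ).card : ℝ) * (1 / (8 * Real.pi) * ψ n)
        ≤ ∑ k ∈ band 1 1 N \ γ, fejerCoeff (2 * N) k * ψ n := by
      rw [← nsmul_eq_mul]
      refine Finset.card_nsmul_le_sum _ _ _ fun k hk => mul_le_mul_of_nonneg_right ?_ hψn.le
      simp only [band, Finset.mem_sdiff, Finset.mem_union, Finset.mem_Icc] at hk
      exact le_fejerCoeff hN1 (by omega) (by omega)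
    -- The band has 2N = 2n + 2⌈L⌉ frequencies, and γ removes at most 2n of them.
    have hcard : 2 * L ≤ ((band 1 1 N \ γ).card : ℝ) := by
      have h1 := Finset.le_card_sdiff γ (band 1 1 N)
      rw [card_band_one] at h1
      have h2 : 2 * ⌈L⌉₊ ≤ (band 1 1 N \ γ).card := by omega
      have h3 : (2 * ⌈L⌉₊ : ℝ) ≤ ((band 1 1 N \ γ).card : ℝ) := by exact_mod_cast h2
      linarith [Nat.le_ceil L]
    calc ψ n * L / 2 = 2 * Real.pi * (2 * L * (1 / (8 * Real.pi) * ψ n)) := by field_simp; norm_num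
      _ ≤ 2 * Real.pi * (((band 1 1 N \ γ).card : ℝ) * (1 / (8 * Real.pi) * ψ n)) := by gcongr
      _ ≤ _ := by gcongr
  have hmeas : AEMeasurable (fun t => ‖(f t : ℂ) - partialSum γ f t‖ₑ) periodMeasure := by
    have h1 : Continuous f := Complex.continuous_re.comp (continuous_trigPoly _ _)
    have h2 : Continuous (partialSum γ f) := continuous_trigPoly (coeff f) γ
    exact (Continuous.enorm (by fun_prop)).measurable.aemeasurable
  have hmeas' : AEMeasurable (fun t => ‖g t‖ₑ) periodMeasure :=
    (continuous_trigPoly _ _).enorm.measurable.aemeasurable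
  have hholder : ‖∫ t, ((f t : ℂ) - partialSum γ f t) * (starRingEnd ℂ) (g t) ∂periodMeasure‖ₑ
      ≤ eLpNorm (fun x => (f x : ℂ) - partialSum γ f x) (ENNReal.ofReal s) periodMeasure *
        eLpNorm g (ENNReal.ofReal s') periodMeasure := by
    have hsne : ENNReal.ofReal s ≠ 0 := by simpa using hss.pos
    have hsne' : ENNReal.ofReal s' ≠ 0 := by simpa using hss.symm.pos
    rw [eLpNorm_eq_lintegral_rpow_enorm_toReal hsne ENNReal.ofReal_ne_top,
      eLpNorm_eq_lintegral_rpow_enorm_toReal hsne' ENNReal.ofReal_ne_top,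
      ENNReal.toReal_ofReal hss.pos.le, ENNReal.toReal_ofReal hss.symm.pos.le]
    refine le_trans ?_ (ENNReal.lintegral_mul_le_Lp_mul_Lq periodMeasure hss hmeas hmeas')
    refine (enorm_integral_le_lintegral_enorm _).trans (le_of_eq ?_)
    refine lintegral_congr fun t => ?_
    rw [enorm_mul, Pi.mul_apply]
    congr 1
    rw [← ofReal_norm, ← ofReal_norm, Complex.norm_conj]
  have hfin := (hpair.trans hholder).trans (mul_le_mul_right hgnorm _)
  have hb0 : 0 < G * L ^ (1 - 1 / s') := by positivity
  have heq : 1 / (2 * G) * (ψ n * L ^ (1 / s')) = (ψ n * L / 2) / (G * L ^ (1 - 1 / s')) := by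
    have e : L = L ^ (1 / s') * L ^ (1 - 1 / s') := by
      rw [← Real.rpow_add hL, add_sub_cancel, Real.rpow_one]
    have h1 : 0 < L ^ (1 - 1 / s') := by positivity
    rw [eq_div_iff hb0.ne']
    conv_rhs => rw [e]
    field_simp
  rw [heq, ENNReal.ofReal_div_of_pos hb0]
  exact ENNReal.div_le_of_le_mul hfin

/-! ### Assembling the two bounds -/

lemma sameOrder_of_le_of_le {a b w : ℕ → ℝ≥0∞} {c₁ C₁ c₂ C₂ : ℝ≥0} (hc₁ : 0 < c₁) (hC₁ : 0 < C₁)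
    (hc₂ : 0 < c₂) (hC₂ : 0 < C₂) (ha : ∀ n, 1 ≤ n → c₁ * w n ≤ a n ∧ a n ≤ C₁ * w n)
    (hb : ∀ n, 1 ≤ n → c₂ * w n ≤ b n ∧ b n ≤ C₂ * w n) : SameOrder a b := by
  refine ⟨c₂ / C₁, C₂ / c₁, by positivity, by positivity, fun n hn => ⟨?_, ?_⟩⟩
  · calc ((c₂ / C₁ : ℝ≥0) : ℝ≥0∞) * a n ≤ ((c₂ / C₁ : ℝ≥0) : ℝ≥0∞) * (C₁ * w n) := by
          gcongr; exact (ha n hn).2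
      _ = c₂ * w n := by rw [← mul_assoc, ← ENNReal.coe_mul, div_mul_cancel₀ _ hC₁.ne']
      _ ≤ b n := (hb n hn).1
  · calc b n ≤ C₂ * w n := (hb n hn).2
      _ = ((C₂ / c₁ : ℝ≥0) : ℝ≥0∞) * (c₁ * w n) := by
          rw [← mul_assoc, ← ENNReal.coe_mul, div_mul_cancel₀ _ hc₁.ne']
      _ ≤ _ := by gcongr; exact (ha n hn).1

lemma exists_bestOrthClass_bounds {ψ : ℝ → ℝ} (hψ : ψ ∈ classMTwo)
    (hratio : IncreasesToInfinity (decayRatio ψ)) {s s' : ℝ} (hss : s.HolderConjugate s') (β : ℝ) :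
    ∃ c C : ℝ≥0, 0 < c ∧ 0 < C ∧ ∀ n : ℕ, 1 ≤ n → ∀ m : ℕ, m = 2 * n - 1 ∨ m = 2 * n →
      c * ENNReal.ofReal (ψ n * (eta ψ n - n) ^ (1 / s')) ≤
        bestOrthClass m (ENNReal.ofReal s) (psiClass ψ β 1) ∧
      bestOrthClass m (ENNReal.ofReal s) (psiClass ψ β 1) ≤
        C * ENNReal.ofReal (ψ n * (eta ψ n - n) ^ (1 / s')) := by
  obtain ⟨c, hc0, hc⟩ := exists_le_eLpNorm_sub_partialSum hψ hratio hss β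
  obtain ⟨C, hC0, hC⟩ := exists_eLpNorm_sub_partialSum_le hψ hss.lt β
  have hexp : 1 - 1 / s = 1 / s' := by
    rw [one_div, one_div]; linarith [hss.inv_add_inv_eq_one]
  rw [hexp] at hC
  refine ⟨c.toNNReal, C.toNNReal, Real.toNNReal_pos.2 hc0, Real.toNNReal_pos.2 hC0,
    fun n hn m hm => ⟨?_, ?_⟩⟩
  · obtain ⟨f, hf, hfγ⟩ := hc n hn
    rw [← ENNReal.ofReal, ← ENNReal.ofReal_mul hc0.le]
    refine le_trans ?_ (le_iSup₂_of_le f hf le_rfl)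
    exact le_iInf₂ fun γ hγ => hfγ γ (by omega)
  · rw [← ENNReal.ofReal, ← ENNReal.ofReal_mul hC0.le]
    refine iSup₂_le fun f hf => ?_
    -- An interval with exactly m integers: its right endpoint is n for m = 2n - 1 and n + 1 for m =
    -- 2n, so every omitted frequency has modulus at least n.
    refine iInf₂_le_of_le (Finset.Ioo (-n : ℤ) (m + 1 - n : ℕ)) ?_
      (hC n hn (m + 1 - n) n (by omega) le_rfl f hf)
    rw [Int.card_Ioo]
    omega

end OrthApprox

theorem theorem3 (s s' : ℝ) (hs : 1 < s) (hs' : 1 / s + 1 / s' = 1)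
    (ψ : ℝ → ℝ) (hψ : ψ ∈ OrthApprox.classMTwo)
    (hratio : OrthApprox.IncreasesToInfinity (OrthApprox.decayRatio ψ)) (β : ℝ) :
    OrthApprox.SameOrder
      (fun n => OrthApprox.bestOrthClass (2 * n - 1) (ENNReal.ofReal s)
        (OrthApprox.psiClass ψ β 1))
      (fun n => OrthApprox.bestOrthClass (2 * n) (ENNReal.ofReal s)
        (OrthApprox.psiClass ψ β 1)) ∧
    OrthApprox.SameOrder
      (fun n => OrthApprox.bestOrthClass (2 * n) (ENNReal.ofReal s)
        (OrthApprox.psiClass ψ β 1))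
      (fun n => ENNReal.ofReal (ψ n * (OrthApprox.eta ψ n - n) ^ (1 / s'))) := by
  have hss : s.HolderConjugate s' := by
    rw [Real.holderConjugate_iff]
    exact ⟨hs, by rwa [one_div, one_div] at hs'⟩
  obtain ⟨c, C, hc, hC, h⟩ := OrthApprox.exists_bestOrthClass_bounds hψ hratio hss β
  refine ⟨OrthApprox.sameOrder_of_le_of_le hc hC hc hC (fun n hn => h n hn _ (Or.inl rfl))
      (fun n hn => h n hn _ (Or.inr rfl)),
    OrthApprox.sameOrder_of_le_of_le hc hC one_pos one_pos (fun n hn => h n hn _ (Or.inr rfl))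
      (fun n _ => ?_)⟩
  rw [ENNReal.coe_one, one_mul]
  exact ⟨le_rfl, le_rfl⟩
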